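/- Let $P\subset\mathbb{R}^2$ be a simple plane polygon, i.e. the closed region bounded by a closed polygonal curve with finitely many vertices and edges and no self-intersections ($P$ need not be convex). A *single fold* of $P$ is a set obtained by choosing a line $\ell$ and reflecting one or more connected components of $P\setminus\ell$ across $\ell$, leaving the rest of $P$ in place. For $c>0$, let $cP$ denote the family of all images of $P$ under scaling by $c$ followed by an isometry of the plane (rotations, reflections and translations), and let the *1-fold cover factor* $c_1^*(P)\in[0,\infty]$ be the infimum of all $c>0$ such that every single fold of $P$ is contained in some member of $cP$. Then there is a single fold of $P$ that is not contained in any isometric copy of $P$, and moreover $c_1^*(P)>1$. -/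

import Mathlib

open scoped Pointwise ENNReal

namespace Folding

noncomputable section

/-- The Euclidean plane. -/
abbrev Plane : Type := EuclideanSpace ℝ (Fin 2)

/-- A closed polygonal curve with `n` vertices and edges is *simple* if it has at least three
vertices, its vertices are pairwise distinct, consecutive edges meet only in their common vertex,
and non-consecutive edges are disjoint. The edge with index `i` joins vertex `i` to the cyclically
next vertex `finRotate n i`. -/
structure IsSimple {n : ℕ} (v : Polygon Plane n) : Prop where
  three_le : 3 ≤ n
  injective : Function.Injective v.vertices
  consecutive : ∀ i : Fin n,
    v.edgeSet ℝ i ∩ v.edgeSet ℝ (finRotate n i) = {v.vertices (finRotate n i)}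
  disjoint : ∀ i j : Fin n, j ≠ i → j ≠ finRotate n i → i ≠ finRotate n j →
    Disjoint (v.edgeSet ℝ i) (v.edgeSet ℝ j)

/-- The closed region bounded by a closed curve `B` in the plane: the curve together with the
bounded connected components of its complement. -/
def enclosedRegion (B : Set Plane) : Set Plane :=
  B ∪ {x | x ∉ B ∧ Bornology.IsBounded (connectedComponentIn Bᶜ x)}

/-- A (simple) plane polygon: a closed region bounded by a finite cyclic sequence of vertices and
edges with no self-intersections. It need not be convex. -/
def IsPlanePolygon (P : Set Plane) : Prop :=
  ∃ (n : ℕ) (v : Polygon Plane n), IsSimple v ∧ P = enclosedRegion (v.boundary ℝ)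

/-- The connected components of a subset `A` of the plane. -/
def components (A : Set Plane) : Set (Set Plane) :=
  {C | ∃ x ∈ A, C = connectedComponentIn A x}

/-- The shape obtained from `S` by reflecting the part `M` of `S` across `ℓ` and leaving the
rest of `S` in place. -/
def foldAlong (S : Set Plane) (ℓ : AffineSubspace ℝ Plane) [Nonempty ℓ] (M : Set Plane) :
    Set Plane :=
  (S \ M) ∪ EuclideanGeometry.reflection ℓ '' M

/-- The family of shapes that can be generated by a single fold of `S`: choose a line `ℓ` and
reflect one or more connected components of `S \ ℓ` across `ℓ`. -/
def singleFolds (S : Set Plane) : Set (Set Plane) :=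
  {F | ∃ (ℓ : AffineSubspace ℝ Plane) (_ : Nonempty ℓ) (K : Set (Set Plane)),
      Module.finrank ℝ ℓ.direction = 1 ∧
      K ⊆ components (S \ (ℓ : Set Plane)) ∧ K.Nonempty ∧
      F = foldAlong S ℓ (⋃₀ K)}

/-- The family `cS` of all copies of `S` that have been scaled by `c` and then moved by an
isometry of the plane (rotated, reflected and translated). -/
def scaledCopies (c : ℝ) (S : Set Plane) : Set (Set Plane) :=
  {T | ∃ g : Plane ≃ᵢ Plane, T = g '' (c • S)}

/-- `cS` is a 1-fold cover of `S` if every single fold of `S` is covered by a member of `cS`. -/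
def IsOneFoldCover (c : ℝ) (S : Set Plane) : Prop :=
  ∀ F ∈ singleFolds S, ∃ T ∈ scaledCopies c S, F ⊆ T

/-- The 1-fold cover factor `c₁*(S)`: the infimum of all `c > 0` such that `cS` is a 1-fold
cover of `S`, which is `∞` if there is no such `c`. -/
def oneFoldCoverFactor (S : Set Plane) : ℝ≥0∞ :=
  ⨅ (c : ℝ) (_ : 0 < c ∧ IsOneFoldCover c S), ENNReal.ofReal c

end

end Folding

/-! Let d be the diameter of P. A point of P at maximal distance from another point of P is a
vertex, so P has finitely many diameters, and near an end of one P lies in an angle with finite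
slopes relative to it (`IsSimple.exists_isCorner`). Take a diameter ab and fold along the line
through its midpoint that makes with it a small angle of sine s and cosine c, turning over the side
of a; let a' be the image of a. Then a' and b are at distance dc = d - ds²/2 + O(s⁴). If the cover
factor were at most 1, a similarity of ratio at least 1 - s⁴ would carry the fold into P. It takes
a' and b close to the ends p and q of some diameter, with room of only about ds²/2 along pq. Since
the corners at p and q have bounded slopes, the displacement and the rotation are O(s²)
(`Placement.bounds`).

First order: the point where the fold line meets the side of slope t at a is seen from a' with slope
tending to -t, whereas a fixed point of that side keeps slope t. So the corner at p reaches from at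
most -t to at least t (`PlacementSeq.left_le`, `PlacementSeq.le_right`). If t is the largest slope
at any diameter, the corner at p has slopes exactly -t and t. Breaking ties by the other slope at a
and then by a slope at b makes the corner at a symmetric too, and confines the corner at q to slopes
between -t' and t', where -t' is the lower slope at b.

Second order: the crossing points of the fold line with the sides at a and at b overshoot the slopes
-t and -t' by amounts of order s². To fit, the images of a' and b must together retreat from p and q
by s²(d/2 + d/(4t²) + d/(4t'²)) to leading order, more than the available ds²/2 (`second_order`,
`PlacementSeq.false`). -/

namespace Folding

/-! ### Quantitative estimates for a single placement -/

open Filter Topology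

/-- The real data of a placement of the folded shape in the polygon. The fold line makes an angle
with sine `s` and cosine `c` with a diameter of length `d`; the similarity has ratio `ρ` and turns
the frame of the fold by the angle with cosine `C` and sine `S`; `(X, Y)` and `(X', Y')` are the
positions of the two distinguished points in the corners with slopes `T₁, T₂` and `T₁', T₂'`. -/
structure Placement (d τ t t' r T₁ T₂ T₁' T₂' s c ρ C S X Y X' Y' : ℝ) : Prop where
  ratio_ge : 1 - s ^ 4 ≤ ρ
  ratio_le : ρ * c ≤ 1
  circle : C ^ 2 + S ^ 2 = 1
  cos_nonneg : 0 ≤ C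
  sin_small : τ * |S| ≤ 1 / 2
  height : Y + Y' = d - ρ * d * c * C
  shift : X' = X + ρ * d * c * S
  nonneg : 0 ≤ Y
  nonneg' : 0 ≤ Y'
  left : T₁ * Y ≤ X
  right : X ≤ T₂ * Y
  left' : T₁' * Y' ≤ X'
  right' : X' ≤ T₂' * Y'
  crossing : T₁ * (Y + ρ * (d / 2 * s / (s + t * c) * (c - t * s) * C + d / 2 * s * S)) ≤
    X + ρ * (d / 2 * s / (s + t * c) * (c - t * s) * S - d / 2 * s * C)
  retained : X + ρ * (r * (c - t * s) * S + (r * (s + t * c) - d * s) * C) ≤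
    T₂ * (Y + ρ * (r * (c - t * s) * C - (r * (s + t * c) - d * s) * S))
  crossing' : 0 < t' →
    0 ≤ Y' + ρ * (d / 2 * s / (s + t' * c) * (c - t' * s) * C - d / 2 * s * S) ∧
    T₁' * (Y' + ρ * (d / 2 * s / (s + t' * c) * (c - t' * s) * C - d / 2 * s * S)) ≤
    X' + ρ * (-(d / 2 * s / (s + t' * c) * (c - t' * s) * S) - d / 2 * s * C)

theorem abs_le_mul_of_slopes {T₁ T₂ τ X Y : ℝ} (h₁ : -τ ≤ T₁) (h₂ : T₂ ≤ τ) (hY : 0 ≤ Y)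
    (hl : T₁ * Y ≤ X) (hr : X ≤ T₂ * Y) : |X| ≤ τ * Y :=
  abs_le.2 ⟨by nlinarith, by nlinarith⟩

theorem sqrt_one_sub_sq_ge {s : ℝ} (hs : s ^ 2 ≤ 1) :
    1 - s ^ 2 / 2 - s ^ 4 / 2 ≤ √(1 - s ^ 2) := by
  apply Real.le_sqrt_of_sq_le
  nlinarith [sq_nonneg s, mul_nonneg (sq_nonneg s) (sub_nonneg.2 hs), sq_nonneg (s ^ 2),
    mul_nonneg (sq_nonneg (s ^ 2)) (sub_nonneg.2 hs),
    mul_nonneg (mul_nonneg (sq_nonneg (s ^ 2)) (sub_nonneg.2 hs)) (sq_nonneg s)]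

/-- A placement is close to the identity, up to an error that is quadratic in `s`. -/
theorem Placement.bounds {d τ t t' r T₁ T₂ T₁' T₂' s ρ C S X Y X' Y' : ℝ}
    (h : Placement d τ t t' r T₁ T₂ T₁' T₂' s (√(1 - s ^ 2)) ρ C S X Y X' Y')
    (hd : 0 < d) (hτ : 1 ≤ τ) (hs : 0 < s) (hs' : s ≤ 1 / 2)
    (h₁ : -τ ≤ T₁) (h₂ : T₂ ≤ τ) (h₁' : -τ ≤ T₁') (h₂' : T₂' ≤ τ) :
    |S| ≤ 8 * τ * s ^ 2 ∧ Y ≤ 6 * d * s ^ 2 ∧ |X| ≤ 6 * τ * d * s ^ 2 ∧ 1 - S ^ 2 ≤ C ∧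
      C ≤ 1 ∧ 1 / 2 ≤ ρ ∧ ρ ≤ 2 := by
  have hs2 : s ^ 2 ≤ 1 / 4 := by nlinarith
  have hs4 : s ^ 4 ≤ 1 / 16 := by nlinarith [sq_nonneg s]
  have hs42 : s ^ 4 ≤ s ^ 2 / 4 := by nlinarith [sq_nonneg s]
  have hc := sqrt_one_sub_sq_ge (show s ^ 2 ≤ 1 by linarith)
  have hc1 : √(1 - s ^ 2) ≤ 1 := Real.sqrt_le_one.2 (by nlinarith)
  set c := √(1 - s ^ 2)
  have hc2 : 3 / 4 ≤ c := by linarith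
  obtain ⟨hρ, hρ', hcirc, hC, hSm, hh, hsh, hY, hY', hl, hr, hl', hr', -, -, -⟩ := h
  have hρ2 : 1 / 2 ≤ ρ := by linarith
  have hX := abs_le_mul_of_slopes h₁ h₂ hY hl hr
  have hX' := abs_le_mul_of_slopes h₁' h₂' hY' hl' hr'
  have hC1 : C ≤ 1 := by nlinarith only [sq_nonneg S, hcirc, hC]
  have hCS : 1 - S ^ 2 ≤ C := by nlinarith only [hcirc, hC, hC1]
  have hρc : 1 - s ^ 2 ≤ ρ * c := by
    have : (1 - s ^ 4) * (1 - s ^ 2 / 2 - s ^ 4 / 2) ≤ ρ * c :=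
      mul_le_mul hρ hc (by linarith) (by linarith)
    have h0 : (1 - s ^ 4) * (1 - s ^ 2 / 2 - s ^ 4 / 2) - (1 - s ^ 2) =
        s ^ 2 * (1 / 2 * (1 - 4 * s ^ 2) + s ^ 2 / 2 + s ^ 4 / 2 + s ^ 6 / 2) := by ring
    have h1 : 0 ≤ s ^ 2 * (1 / 2 * (1 - 4 * s ^ 2) + s ^ 2 / 2 + s ^ 4 / 2 + s ^ 6 / 2) := by
      have : 0 ≤ 1 - 4 * s ^ 2 := by linarith
      positivity
    linarith
  obtain ⟨w, hw⟩ : ∃ w, w = ρ * c := ⟨_, rfl⟩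
  rw [← hw] at hρc
  have hw0 : 3 / 4 ≤ w := by linarith
  have e1 : ρ * d * c * S = d * w * S := by rw [hw]; ring
  have e2 : ρ * d * c * C = d * w * C := by rw [hw]; ring
  rw [e1] at hsh
  rw [e2] at hh
  have hw1 : 0 < w := by linarith
  have hρ3 : ρ ≤ 2 := by nlinarith only [hc2, hρ', hρ2]
  clear e1 e2 hw hc hc1 hc2 hρ' hρ hs4 hs42
  have hS0 := abs_nonneg S
  have hSS : S ^ 2 = |S| * |S| := by rw [← sq_abs]; ring
  have hV : Y + Y' ≤ d * s ^ 2 + d * S ^ 2 := by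
    have h1 : (1 - s ^ 2) * (1 - S ^ 2) ≤ w * C := by
      have hS1 : 0 ≤ 1 - S ^ 2 := by linarith only [hcirc, sq_nonneg C]
      exact mul_le_mul hρc hCS hS1 (by linarith)
    have h2 : 1 - s ^ 2 - S ^ 2 ≤ w * C := by
      linarith only [h1, mul_nonneg (sq_nonneg s) (sq_nonneg S)]
    linarith only [mul_le_mul_of_nonneg_left h2 hd.le, hh]
  have hSX : d * w * |S| ≤ τ * (Y + Y') := by
    have h1 : d * w * |S| = |X' - X| := by
      rw [hsh, add_sub_cancel_left, abs_mul, abs_of_nonneg (show 0 ≤ d * w by positivity)]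
    rw [h1]
    linarith only [abs_sub X' X, hX, hX']
  -- The lateral shift caused by the rotation is paid for by the heights at the two ends. As τ|S| ≤
  -- 1/2, the quadratic term τS² is at most |S|/2, which is absorbed on the left because w ≥ 3/4.
  have key : w * |S| ≤ τ * s ^ 2 + |S| / 2 := by
    have h0 : d * (w * |S|) ≤ d * (τ * s ^ 2 + |S| / 2) := by
      have h1 : τ * (Y + Y') ≤ τ * (d * s ^ 2 + d * S ^ 2) :=
        mul_le_mul_of_nonneg_left hV (by linarith)
      have h2 : (τ * |S|) * (d * |S|) ≤ 1 / 2 * (d * |S|) :=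
        mul_le_mul_of_nonneg_right hSm (by positivity)
      rw [hSS] at h1
      linarith only [h1, h2, hSX]
    exact le_of_mul_le_mul_left h0 hd
  have hSb : |S| ≤ 4 * τ * s ^ 2 := by
    linarith only [key, mul_le_mul_of_nonneg_right hw0 hS0]
  have hSq : S ^ 2 ≤ 2 * s ^ 2 := by
    rw [hSS]
    calc |S| * |S| ≤ |S| * (4 * τ * s ^ 2) := mul_le_mul_of_nonneg_left hSb hS0
      _ = (τ * |S|) * (4 * s ^ 2) := by ring
      _ ≤ 1 / 2 * (4 * s ^ 2) := mul_le_mul_of_nonneg_right hSm (by positivity)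
      _ = _ := by ring
  have hYb : Y ≤ 6 * d * s ^ 2 := by
    linarith only [mul_le_mul_of_nonneg_left hSq hd.le, hV, hY', mul_nonneg hd.le (sq_nonneg s)]
  refine ⟨by linarith only [mul_nonneg (show 0 ≤ τ by linarith) (sq_nonneg s), hSb], hYb, ?_, hCS,
    hC1, hρ2, hρ3⟩
  calc |X| ≤ τ * Y := hX
    _ ≤ τ * (6 * d * s ^ 2) := mul_le_mul_of_nonneg_left hYb (by linarith)
    _ = _ := by ring

end Folding

/-! ### Limits of placements as the fold angle tends to zero -/

namespace Folding

open Filter Topology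

/-- A sequence of placements with `s` tending to zero, in normalized form. -/
structure PlacementSeq (d τ t t' r T₁ T₂ T₁' T₂' : ℝ) (s ρ C S X Y X' Y' : ℕ → ℝ) : Prop where
  pos : ∀ n, 0 < s n
  le : ∀ n, s n ≤ 1 / 2
  placement : ∀ n, Placement d τ t t' r T₁ T₂ T₁' T₂' (s n) (√(1 - s n ^ 2)) (ρ n) (C n) (S n)
    (X n) (Y n) (X' n) (Y' n)
  cos_ge : ∀ n, 1 - S n ^ 2 ≤ C n
  tendsto_s : Tendsto s atTop (𝓝 0)
  tendsto_c : Tendsto (fun n ↦ √(1 - s n ^ 2)) atTop (𝓝 1)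
  tendsto_ρ : Tendsto ρ atTop (𝓝 1)
  tendsto_C : Tendsto C atTop (𝓝 1)
  tendsto_S : Tendsto (fun n ↦ S n / s n) atTop (𝓝 0)
  tendsto_X : Tendsto (fun n ↦ X n / s n) atTop (𝓝 0)
  tendsto_Y : Tendsto (fun n ↦ Y n / s n) atTop (𝓝 0)

/-- The bounds of `Placement.bounds` are quadratic in s, so S, X and Y remain negligible after
division by s. The ratio is squeezed between 1 - s⁴ and 1/c. -/
theorem exists_placementSeq {d τ t t' r T₁ T₂ T₁' T₂' : ℝ} (hd : 0 < d) (hτ : 1 ≤ τ)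
    (h₁ : -τ ≤ T₁) (h₂ : T₂ ≤ τ) (h₁' : -τ ≤ T₁') (h₂' : T₂' ≤ τ)
    (h : ∃ᶠ s in 𝓝[>] (0 : ℝ), ∃ ρ C S X Y X' Y',
      Placement d τ t t' r T₁ T₂ T₁' T₂' s (√(1 - s ^ 2)) ρ C S X Y X' Y') :
    ∃ s ρ C S X Y X' Y', PlacementSeq d τ t t' r T₁ T₂ T₁' T₂' s ρ C S X Y X' Y' := by
  have h0 : ∀ᶠ s in 𝓝[>] (0 : ℝ), 0 < s ∧ s ≤ 1 / 2 :=
    Filter.eventually_of_mem (Ioc_mem_nhdsGT (by norm_num : (0 : ℝ) < 1 / 2)) fun s hs ↦ hs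
  obtain ⟨s, hs, hP⟩ := exists_seq_forall_of_frequently (h.and_eventually h0)
  choose hP hs0 hs1 using hP
  choose ρ C S X Y X' Y' hP using hP
  have hst : Tendsto s atTop (𝓝 0) := tendsto_nhds_of_tendsto_nhdsWithin hs
  have hb := fun n ↦ (hP n).bounds hd hτ (hs0 n) (hs1 n) h₁ h₂ h₁' h₂'
  choose hS hY hX hC hC1 hρ hρ2 using hb
  have lin : ∀ (f : ℕ → ℝ) (K : ℝ), (∀ n, |f n| ≤ K * s n ^ 2) →
      Tendsto (fun n ↦ f n / s n) atTop (𝓝 0) := by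
    intro f K hf
    refine squeeze_zero_norm (a := fun n ↦ K * s n) (fun n ↦ ?_) (by simpa using hst.const_mul K)
    rw [Real.norm_eq_abs, abs_div, abs_of_pos (hs0 n), div_le_iff₀ (hs0 n)]
    linarith [hf n]
  have tc : Tendsto (fun n ↦ √(1 - s n ^ 2)) atTop (𝓝 1) := by
    have := ((hst.pow 2).const_sub 1).sqrt
    simpa using this
  have tS := lin S _ hS
  have tS' : Tendsto S atTop (𝓝 0) := by
    have := tS.mul hst
    simp only [mul_zero] at this
    exact this.congr fun n ↦ div_mul_cancel₀ _ (hs0 n).ne'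
  refine ⟨s, ρ, C, S, X, Y, X', Y', hs0, hs1, hP, hC, hst, tc, ?_, ?_, tS,
    lin X _ hX, lin Y (6 * d) fun n ↦ by rw [abs_of_nonneg (hP n).nonneg]; exact hY n⟩
  · have a1 : Tendsto (fun n ↦ 1 - s n ^ 4) atTop (𝓝 1) := by
      simpa using (hst.pow 4).const_sub 1
    have a2 : Tendsto (fun n ↦ (√(1 - s n ^ 2))⁻¹) atTop (𝓝 1) := by
      simpa using tc.inv₀ one_ne_zero
    refine tendsto_of_tendsto_of_tendsto_of_le_of_le a1 a2 (fun n ↦ (hP n).ratio_ge) fun n ↦ ?_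
    have : 0 < √(1 - s n ^ 2) := Real.sqrt_pos.2 (by nlinarith [hs0 n, hs1 n])
    rw [← one_div, le_div_iff₀ this]
    exact (hP n).ratio_le
  · refine tendsto_of_tendsto_of_tendsto_of_le_of_le (by simpa using (tS'.pow 2).const_sub 1)
      tendsto_const_nhds hC hC1

/-- Divide the condition on the crossing point by s. In the limit this point has height d/(2t) and
lateral position -d/2, hence slope -t, and it must lie in the target corner. -/
theorem PlacementSeq.left_le {d τ t t' r T₁ T₂ T₁' T₂' : ℝ} {s ρ C S X Y X' Y' : ℕ → ℝ}
    (h : PlacementSeq d τ t t' r T₁ T₂ T₁' T₂' s ρ C S X Y X' Y') (hd : 0 < d) (ht : 0 < t) :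
    T₁ ≤ -t := by
  have ts := h.tendsto_s
  have tc := h.tendsto_c
  have tS : Tendsto S atTop (𝓝 0) := by
    have := h.tendsto_S.mul ts
    simp only [mul_zero] at this
    exact this.congr fun n ↦ div_mul_cancel₀ _ (h.pos n).ne'
  have tq : Tendsto (fun n ↦ d / 2 / (s n + t * √(1 - s n ^ 2)) * (√(1 - s n ^ 2) - t * s n))
      atTop (𝓝 (d / 2 / (0 + t * 1) * (1 - t * 0))) :=
    (tendsto_const_nhds.div (ts.add (tc.const_mul t)) (by simpa using ht.ne')).mul
      (tc.sub (ts.const_mul t))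
  have hlim := le_of_tendsto_of_tendsto'
    ((h.tendsto_Y.add (h.tendsto_ρ.mul ((tq.mul h.tendsto_C).add (tS.const_mul (d / 2))))).const_mul
      T₁)
    (h.tendsto_X.add (h.tendsto_ρ.mul ((tq.mul tS).sub (h.tendsto_C.const_mul (d / 2)))))
    (fun n ↦ by
      have hp := (h.placement n).crossing
      have hs := h.pos n
      rw [← mul_le_mul_iff_left₀ hs]
      have e1 : Y n = Y n / s n * s n := (div_mul_cancel₀ _ hs.ne').symm
      have e2 : X n = X n / s n * s n := (div_mul_cancel₀ _ hs.ne').symm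
      have e3 : d / 2 * s n / (s n + t * √(1 - s n ^ 2)) * (√(1 - s n ^ 2) - t * s n) =
        d / 2 / (s n + t * √(1 - s n ^ 2)) * (√(1 - s n ^ 2) - t * s n) * s n := by ring
      rw [e3, e1, e2] at hp
      generalize d / 2 / (s n + t * √(1 - s n ^ 2)) * (√(1 - s n ^ 2) - t * s n) = q at hp ⊢
      generalize X n / s n = x at hp ⊢
      generalize Y n / s n = y at hp ⊢
      linarith only [hp])
  have : T₁ * (d / 2 / t) ≤ -(d / 2) := by simpa using hlim
  rw [mul_div_assoc', div_le_iff₀ ht] at this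
  nlinarith

/-- The retained point of the side of slope t does not depend on s; in the limit it sits at height r
and lateral position rt in the target corner. -/
theorem PlacementSeq.le_right {d τ t t' r T₁ T₂ T₁' T₂' : ℝ} {s ρ C S X Y X' Y' : ℕ → ℝ}
    (h : PlacementSeq d τ t t' r T₁ T₂ T₁' T₂' s ρ C S X Y X' Y') (hr : 0 < r) :
    t ≤ T₂ := by
  have ts := h.tendsto_s
  have tc := h.tendsto_c
  have lim : ∀ f : ℕ → ℝ, Tendsto (fun n ↦ f n / s n) atTop (𝓝 0) → Tendsto f atTop (𝓝 0) := by
    intro f hf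
    have := hf.mul ts
    simp only [mul_zero] at this
    exact this.congr fun n ↦ div_mul_cancel₀ _ (h.pos n).ne'
  have tS := lim _ h.tendsto_S
  have t1 := (tc.sub (ts.const_mul t)).const_mul r
  have t2 := ((ts.add (tc.const_mul t)).const_mul r).sub (ts.const_mul d)
  have hlim := le_of_tendsto_of_tendsto'
    ((lim _ h.tendsto_X).add (h.tendsto_ρ.mul ((t1.mul tS).add (t2.mul h.tendsto_C))))
    (((lim _ h.tendsto_Y).add (h.tendsto_ρ.mul ((t1.mul h.tendsto_C).sub (t2.mul tS)))).const_mul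
      T₂) (fun n ↦ (h.placement n).retained)
  have : r * t ≤ T₂ * r := by simpa using hlim
  nlinarith

/-- The two crossing conditions bound Y and Y' from below, and `hh` fixes their sum. Everything is
divided by s² so that the limit can be taken directly. -/
theorem second_order {d t t' s c ρ C S X Y X' Y' : ℝ} (hd : 0 < d) (ht : 0 < t) (ht' : 0 < t')
    (hs : 0 < s) (hs1 : s ≤ 1 / 2) (hC : 1 - S ^ 2 ≤ C) (hρ : 1 - s ^ 4 ≤ ρ)
    (hcirc : C ^ 2 + S ^ 2 = 1) (hc : 1 - s ^ 2 / 2 - s ^ 4 / 2 ≤ c) (hc0 : 0 < c)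
    (hh : Y + Y' = d - ρ * d * c * C)
    (hx : -t * (Y + ρ * (d / 2 * s / (s + t * c) * (c - t * s) * C + d / 2 * s * S)) ≤
      X + ρ * (d / 2 * s / (s + t * c) * (c - t * s) * S - d / 2 * s * C))
    (hr : X ≤ t * Y) (hr' : X' ≤ t' * Y')
    (hy : -t' * (Y' + ρ * (d / 2 * s / (s + t' * c) * (c - t' * s) * C - d / 2 * s * S)) ≤
      X' + ρ * (-(d / 2 * s / (s + t' * c) * (c - t' * s) * S) - d / 2 * s * C)) :
    ρ / 2 * (C * (d / 2 * (1 + t ^ 2) / (s + t * c) / t + d / 2 * (1 + t' ^ 2) / (s + t' * c) / t') +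
      S / s * ((d / 2 / (s + t' * c) * (c - t' * s) + t' * (d / 2)) / t' -
        (d / 2 / (s + t * c) * (c - t * s) + t * (d / 2)) / t)) ≤
    d * (s ^ 2 + ((1 - s ^ 4) * (1 / 2 + s ^ 2 / 2) +
      (1 - s ^ 4) * (1 - s ^ 2 / 2 - s ^ 4 / 2) * (S / s) ^ 2)) := by
  have hs2 : s ^ 2 ≤ 1 / 4 := by nlinarith only [hs, hs1]
  have hs4 : s ^ 4 ≤ 1 / 16 := by nlinarith only [hs2, sq_nonneg s]
  -- The first-order terms cancel, since the crossing point has limiting slope -u; this is the exact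
  -- second-order overshoot.
  have excess : ∀ u : ℝ, 0 < u → d / 2 * s - u * (d / 2 * s / (s + u * c) * (c - u * s)) =
      s ^ 2 * (d / 2 * (1 + u ^ 2) / (s + u * c)) := by
    intro u hu
    have : s + u * c ≠ 0 := by positivity
    field_simp
    ring
  have e1 := excess t ht
  have e2 := excess t' ht'
  set q := d / 2 * (1 + t ^ 2) / (s + t * c)
  set q' := d / 2 * (1 + t' ^ 2) / (s + t' * c)
  set p := d / 2 / (s + t * c) * (c - t * s) with hp
  set p' := d / 2 / (s + t' * c) * (c - t' * s) with hp'
  have f1 : d / 2 * s / (s + t * c) * (c - t * s) = s * p := by rw [hp]; ring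
  have f2 : d / 2 * s / (s + t' * c) * (c - t' * s) = s * p' := by rw [hp']; ring
  rw [f1] at hx e1
  rw [f2] at hy e2
  clear_value q q' p p'
  -- Eliminating X between the crossing condition and X ≤ tY leaves 2tY on one side.
  have k1 : ρ / 2 * (C * (s ^ 2 * q) - S * (s * (p + t * (d / 2)))) / t ≤ Y := by
    rw [div_le_iff₀ ht, ← e1]
    linarith only [hx, hr]
  have k2 : ρ / 2 * (C * (s ^ 2 * q') + S * (s * (p' + t' * (d / 2)))) / t' ≤ Y' := by
    rw [div_le_iff₀ ht', ← e2]
    linarith only [hy, hr']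
  have k3 : (1 - s ^ 4) * (1 - s ^ 2 / 2 - s ^ 4 / 2) * (1 - S ^ 2) ≤ ρ * c * C :=
    mul_le_mul (mul_le_mul hρ hc (by linarith) (by linarith)) hC
      (by linarith only [hcirc, sq_nonneg C]) (mul_nonneg (by linarith) hc0.le)
  have k4 := mul_le_mul_of_nonneg_left k3 hd.le
  rw [← mul_le_mul_iff_right₀ (show 0 < s ^ 2 by positivity)]
  have g1 : s ^ 2 * (ρ / 2 * (C * (q / t + q' / t') +
      S / s * ((p' + t' * (d / 2)) / t' - (p + t * (d / 2)) / t))) =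
      ρ / 2 * (C * (s ^ 2 * q) - S * (s * (p + t * (d / 2)))) / t +
      ρ / 2 * (C * (s ^ 2 * q') + S * (s * (p' + t' * (d / 2)))) / t' := by
    field_simp
    ring
  have g2 : s ^ 2 * (d * (s ^ 2 + ((1 - s ^ 4) * (1 / 2 + s ^ 2 / 2) +
      (1 - s ^ 4) * (1 - s ^ 2 / 2 - s ^ 4 / 2) * (S / s) ^ 2))) =
      d - d * ((1 - s ^ 4) * (1 - s ^ 2 / 2 - s ^ 4 / 2) * (1 - S ^ 2)) := by
    field_simp
    ring
  rw [g1, g2]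
  linarith only [k1, k2, k4, hh]

theorem PlacementSeq.false {d τ t t' r T₁ T₂ T₁' T₂' : ℝ} {s ρ C S X Y X' Y' : ℕ → ℝ}
    (h : PlacementSeq d τ t t' r T₁ T₂ T₁' T₂' s ρ C S X Y X' Y') (hd : 0 < d) (ht : 0 < t)
    (ht' : 0 < t') (h₁ : T₁ = -t) (h₂ : T₂ ≤ t) (h₁' : -t' ≤ T₁') (h₂' : T₂' ≤ t') : False := by
  have ts := h.tendsto_s
  have tc := h.tendsto_c
  have tS := h.tendsto_S
  have tl : ∀ u : ℝ, 0 < u → Tendsto (fun n ↦ d / 2 * (1 + u ^ 2) / (s n + u * √(1 - s n ^ 2)) / u)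
      atTop (𝓝 (d / 2 * (1 + u ^ 2) / (0 + u * 1) / u)) := fun u hu ↦
    (tendsto_const_nhds.div (ts.add (tc.const_mul u)) (by simpa using hu.ne')).div_const u
  have tg : ∀ u : ℝ, 0 < u → Tendsto
      (fun n ↦ (d / 2 / (s n + u * √(1 - s n ^ 2)) * (√(1 - s n ^ 2) - u * s n) + u * (d / 2)) / u)
      atTop (𝓝 ((d / 2 / (0 + u * 1) * (1 - u * 0) + u * (d / 2)) / u)) := fun u hu ↦
    (((tendsto_const_nhds.div (ts.add (tc.const_mul u)) (by simpa using hu.ne')).mul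
      (tc.sub (ts.const_mul u))).add_const _).div_const u
  have s2 := ts.pow 2
  have s4 := ts.pow 4
  have tL := (s2.add (((s4.const_sub 1).mul ((s2.div_const 2).const_add (1 / 2))).add
    (((s4.const_sub 1).mul (((s2.div_const 2).const_sub 1).sub (s4.div_const 2))).mul
      (tS.pow 2)))).const_mul d
  have hlim := le_of_tendsto_of_tendsto' ((h.tendsto_ρ.div_const 2).mul
    ((h.tendsto_C.mul ((tl t ht).add (tl t' ht'))).add (tS.mul ((tg t' ht').sub (tg t ht))))) tL
    (fun n ↦ ?_)
  -- The limit of the required retreat is d/2 + d/(4t²) + d/(4t'²), against d/2 available.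
  · have : 1 / 2 * (d / 2 * (1 + t ^ 2) / t / t + d / 2 * (1 + t' ^ 2) / t' / t') ≤ d * (1 / 2) := by
      simpa using hlim
    have e : ∀ u : ℝ, 0 < u → d / 2 * (1 + u ^ 2) / u / u = d / 2 + d / 2 / u ^ 2 := by
      intro u hu
      field_simp
      ring
    rw [e t ht, e t' ht'] at this
    have p1 : 0 < d / 2 / t ^ 2 := by positivity
    have p2 : 0 < d / 2 / t' ^ 2 := by positivity
    linarith
  · have hs := h.pos n
    have hs1 := h.le n
    have hC := h.cos_ge n
    obtain ⟨hρ, -, hcirc, hC0, -, hh, -, hY, hY', -, hr, -, hr', hx, -, hy⟩ := h.placement n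
    obtain ⟨hy0, hy⟩ := hy ht'
    have hc := sqrt_one_sub_sq_ge (show s n ^ 2 ≤ 1 by nlinarith)
    have hc0 : 0 < √(1 - s n ^ 2) := Real.sqrt_pos.2 (by nlinarith)
    exact second_order hd ht ht' hs hs1 hC hρ hcirc hc hc0 hh (h₁ ▸ hx) (hr.trans (by gcongr))
      (hr'.trans (by gcongr)) (le_trans (by gcongr) hy)

end Folding

/-! ### Frames, corners, and folds along a line -/

namespace Folding

open scoped RealInnerProductSpace

/-- An orthonormal frame of the plane. -/
structure IsFrame (D N : Plane) : Prop where
  inner_self_fst : ⟪D, D⟫ = 1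
  inner_self_snd : ⟪N, N⟫ = 1
  inner_eq_zero : ⟪D, N⟫ = 0

theorem inner_eq_coords (u v : Plane) : ⟪u, v⟫ = u 0 * v 0 + u 1 * v 1 := by
  simp [PiLp.inner_apply, Fin.sum_univ_two, mul_comm]

namespace IsFrame

variable {D N : Plane}

theorem inner_eq_zero' (h : IsFrame D N) : ⟪N, D⟫ = 0 := by
  rw [real_inner_comm, h.inner_eq_zero]

theorem norm_fst (h : IsFrame D N) : ‖D‖ = 1 := by
  rw [← sq_eq_sq₀ (norm_nonneg _) zero_le_one, ← real_inner_self_eq_norm_sq, h.1, one_pow]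

theorem norm_snd (h : IsFrame D N) : ‖N‖ = 1 := by
  rw [← sq_eq_sq₀ (norm_nonneg _) zero_le_one, ← real_inner_self_eq_norm_sq, h.2, one_pow]

theorem inner_comb_fst (h : IsFrame D N) (x y : ℝ) : ⟪x • D + y • N, D⟫ = x := by
  rw [inner_add_left, real_inner_smul_left, real_inner_smul_left, h.1, h.inner_eq_zero']
  ring

theorem inner_comb_snd (h : IsFrame D N) (x y : ℝ) : ⟪x • D + y • N, N⟫ = y := by
  rw [inner_add_left, real_inner_smul_left, real_inner_smul_left, h.2, h.3]
  ring

theorem neg_right (h : IsFrame D N) : IsFrame D (-N) :=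
  ⟨h.1, by rw [inner_neg_neg, h.2], by simp [h.3]⟩

theorem neg_left (h : IsFrame D N) : IsFrame (-D) N :=
  ⟨by rw [inner_neg_neg, h.1], h.2, by simp [h.3]⟩

theorem coords (h : IsFrame D N) :
    D 0 ^ 2 + N 0 ^ 2 = 1 ∧ D 1 ^ 2 + N 1 ^ 2 = 1 ∧ D 0 * D 1 + N 0 * N 1 = 0 := by
  obtain ⟨h1, h2, h3⟩ := h
  rw [inner_eq_coords] at h1 h2 h3
  have hd : (D 0 * N 1 - D 1 * N 0) ^ 2 = 1 := by
    linear_combination (N 0 ^ 2 + N 1 ^ 2) * h1 + h2 - (D 0 * N 0 + D 1 * N 1) * h3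
  have e0 : N 0 = -D 1 * (D 0 * N 1 - D 1 * N 0) := by
    linear_combination -N 0 * h1 + D 0 * h3
  have e1 : N 1 = D 0 * (D 0 * N 1 - D 1 * N 0) := by
    linear_combination -N 1 * h1 + D 1 * h3
  generalize D 0 * N 1 - D 1 * N 0 = k at hd e0 e1
  rw [e0, e1]
  refine ⟨?_, ?_, ?_⟩
  · linear_combination h1 + D 1 ^ 2 * hd
  · linear_combination h1 + D 0 ^ 2 * hd
  · linear_combination -D 0 * D 1 * hd

theorem eq_sum (h : IsFrame D N) (v : Plane) : v = ⟪v, D⟫ • D + ⟪v, N⟫ • N := by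
  obtain ⟨h1, h2, h3⟩ := h.coords
  ext i
  fin_cases i
  · simp only [inner_eq_coords, Fin.zero_eta, PiLp.add_apply, PiLp.smul_apply, smul_eq_mul]
    linear_combination -v 0 * h1 - v 1 * h3
  · simp only [inner_eq_coords, Fin.mk_one, PiLp.add_apply, PiLp.smul_apply, smul_eq_mul]
    linear_combination -v 1 * h2 - v 0 * h3

theorem inner_eq (h : IsFrame D N) (u v : Plane) :
    ⟪u, v⟫ = ⟪u, D⟫ * ⟪v, D⟫ + ⟪u, N⟫ * ⟪v, N⟫ := by
  conv_lhs => rw [h.eq_sum v]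
  simp only [inner_add_right, inner_smul_right]
  ring

theorem norm_le (h : IsFrame D N) (v : Plane) : ‖v‖ ≤ |⟪v, D⟫| + |⟪v, N⟫| := by
  conv_lhs => rw [h.eq_sum v]
  refine (norm_add_le _ _).trans (le_of_eq ?_)
  rw [norm_smul, norm_smul, h.norm_fst, h.norm_snd, mul_one, mul_one, Real.norm_eq_abs, Real.norm_eq_abs]

/-- Two frames differ by a rotation, possibly after reversing the second vector. -/
theorem exists_rotation (h : IsFrame D N) {E M : Plane} (h' : IsFrame E M) :
    ∃ σ C S : ℝ, (σ = 1 ∨ σ = -1) ∧ C ^ 2 + S ^ 2 = 1 ∧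
      E = C • D + S • (σ • N) ∧ M = (-S) • D + C • (σ • N) := by
  have e1 := h.eq_sum E
  have e2 := h.eq_sum M
  have i1 := h'.1
  have i2 := h'.2
  have i3 := h'.3
  rw [h.inner_eq] at i1 i2 i3
  set p := ⟪E, D⟫
  set q := ⟪E, N⟫
  set u := ⟪M, D⟫
  set v := ⟪M, N⟫
  have hd : (p * v - q * u) ^ 2 = 1 := by
    linear_combination (u ^ 2 + v ^ 2) * i1 + i2 - (p * u + q * v) * i3
  have e0 : u = -q * (p * v - q * u) := by
    linear_combination -u * i1 + p * i3
  have e1' : v = p * (p * v - q * u) := by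
    linear_combination -v * i1 + q * i3
  generalize p * v - q * u = σ at hd e0 e1'
  have hσ : σ = 1 ∨ σ = -1 := mul_self_eq_one_iff.1 (by rw [← sq, hd])
  refine ⟨σ, p, q * σ, hσ, ?_, ?_, ?_⟩
  · linear_combination i1 + q ^ 2 * hd
  · rw [smul_smul, mul_assoc, ← sq, hd, mul_one]
    exact e1
  · rw [smul_smul, e2]
    congr 2
    · linear_combination e0

end IsFrame

/-- Near `a`, the set `P` is contained in the angle spanned by the directions `D + t₁ N` and
`D + t₂ N`, and it contains initial segments of both sides of this angle. -/
structure IsCorner (P : Set Plane) (a D N : Plane) (t₁ t₂ R : ℝ) : Prop where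
  lt : t₁ < t₂
  pos : 0 < R
  side_fst : ∀ s, 0 ≤ s → s ≤ R → a + s • (D + t₁ • N) ∈ P
  side_snd : ∀ s, 0 ≤ s → s ≤ R → a + s • (D + t₂ • N) ∈ P
  slope : ∀ Z ∈ P, dist Z a < R → t₁ * ⟪Z - a, D⟫ ≤ ⟪Z - a, N⟫ ∧ ⟪Z - a, N⟫ ≤ t₂ * ⟪Z - a, D⟫

namespace IsCorner

variable {P : Set Plane} {a D N : Plane} {t₁ t₂ R : ℝ}

theorem nonneg (h : IsCorner P a D N t₁ t₂ R) {Z : Plane} (hZ : Z ∈ P) (hd : dist Z a < R) :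
    0 ≤ ⟪Z - a, D⟫ := by
  obtain ⟨h1, h2⟩ := h.slope Z hZ hd
  nlinarith [h.lt]

theorem mono (h : IsCorner P a D N t₁ t₂ R) {r : ℝ} (hr : 0 < r) (hrR : r ≤ R) :
    IsCorner P a D N t₁ t₂ r :=
  ⟨h.lt, hr, fun s h0 h1 ↦ h.side_fst s h0 (h1.trans hrR),
    fun s h0 h1 ↦ h.side_snd s h0 (h1.trans hrR), fun Z hZ hd ↦ h.slope Z hZ (hd.trans_le hrR)⟩

theorem neg (h : IsCorner P a D N t₁ t₂ R) : IsCorner P a D (-N) (-t₂) (-t₁) R := by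
  refine ⟨neg_lt_neg h.lt, h.pos, fun s h0 h1 ↦ ?_, fun s h0 h1 ↦ ?_, fun Z hZ hd ↦ ?_⟩
  · simpa using h.side_snd s h0 h1
  · simpa using h.side_fst s h0 h1
  · obtain ⟨h1, h2⟩ := h.slope Z hZ hd
    rw [inner_neg_right]
    exact ⟨by linarith, by linarith⟩

end IsCorner

/-- A component of P minus the line cannot change sides, by the intermediate value theorem. Choosing
all components on the negative side therefore turns over exactly the part of P in an open
half-plane. -/
theorem exists_fold (P : Set Plane) {w n : Plane} (m : Plane) (hf : IsFrame w n)
    (hP : ∃ Z ∈ P, ⟪Z - m, n⟫ < 0) :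
    ∃ F ∈ singleFolds P, (∀ Z ∈ P, 0 ≤ ⟪Z - m, n⟫ → Z ∈ F) ∧
      ∀ Z ∈ P, ⟪Z - m, n⟫ < 0 → Z - (2 * ⟪Z - m, n⟫) • n ∈ F := by
  have hw : w ≠ 0 := by
    rintro rfl
    simpa using hf.inner_self_fst
  let ℓ : AffineSubspace ℝ Plane := AffineSubspace.mk' m (ℝ ∙ w)
  have hℓ : Nonempty ℓ := ⟨⟨m, AffineSubspace.self_mem_mk' _ _⟩⟩
  have hmem : ∀ Z, Z ∈ (ℓ : Set Plane) ↔ ⟪Z - m, n⟫ = 0 := by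
    intro Z
    simp only [ℓ, SetLike.mem_coe, AffineSubspace.mem_mk', vsub_eq_sub,
      Submodule.mem_span_singleton]
    constructor
    · rintro ⟨r, hr⟩
      rw [← hr, inner_smul_left, hf.inner_eq_zero, mul_zero]
    · intro h
      exact ⟨⟪Z - m, w⟫, by conv_rhs => rw [hf.eq_sum (Z - m), h, zero_smul, add_zero]⟩
  let K : Set (Set Plane) := {A | ∃ Z ∈ P, ⟪Z - m, n⟫ < 0 ∧
    A = connectedComponentIn (P \ (ℓ : Set Plane)) Z}
  have hdiff : ∀ Z ∈ P, ⟪Z - m, n⟫ < 0 → Z ∈ P \ (ℓ : Set Plane) := fun Z hZ h ↦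
    ⟨hZ, fun h' ↦ h.ne ((hmem Z).1 h')⟩
  have hK : ∀ Z, Z ∈ ⋃₀ K ↔ Z ∈ P ∧ ⟪Z - m, n⟫ < 0 := by
    intro Z
    constructor
    · rintro ⟨A, ⟨W, hW, hWn, rfl⟩, hZ⟩
      have hZ' := connectedComponentIn_subset _ _ hZ
      refine ⟨hZ'.1, ?_⟩
      by_contra! hcon
      have hc : ContinuousOn (fun Y : Plane ↦ ⟪Y - m, n⟫)
          (connectedComponentIn (P \ (ℓ : Set Plane)) W) := by fun_prop
      obtain ⟨Y, hY, hY0⟩ := isPreconnected_connectedComponentIn.intermediate_value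
        (mem_connectedComponentIn (hdiff W hW hWn)) hZ hc ⟨hWn.le, hcon⟩
      exact (connectedComponentIn_subset _ _ hY).2 ((hmem Y).2 hY0)
    · rintro ⟨hZ, hn⟩
      exact ⟨_, ⟨Z, hZ, hn, rfl⟩, mem_connectedComponentIn (hdiff Z hZ hn)⟩
  refine ⟨foldAlong P ℓ (⋃₀ K), ⟨ℓ, hℓ, K, ?_, ?_, ?_, rfl⟩, ?_, ?_⟩
  · rw [AffineSubspace.direction_mk']
    exact finrank_span_singleton hw
  · rintro _ ⟨Z, hZ, hn, rfl⟩
    exact ⟨Z, hdiff Z hZ hn, rfl⟩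
  · obtain ⟨Z, hZ, hn⟩ := hP
    exact ⟨_, Z, hZ, hn, rfl⟩
  · intro Z hZ hn
    exact Or.inl ⟨hZ, fun h ↦ hn.not_gt ((hK Z).1 h).2⟩
  · intro Z hZ hn
    refine Or.inr ⟨Z, (hK Z).2 ⟨hZ, hn⟩, ?_⟩
    have h1 : Z - ⟪Z - m, n⟫ • n ∈ ℓ := by
      rw [← SetLike.mem_coe, hmem, sub_right_comm, inner_sub_left, inner_smul_left,
        hf.inner_self_snd]
      simp
    have h2 : ⟪Z - m, n⟫ • n ∈ ℓ.directionᗮ := by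
      rw [AffineSubspace.direction_mk', Submodule.mem_orthogonal_singleton_iff_inner_right,
        inner_smul_right, hf.inner_eq_zero, mul_zero]
    have := EuclideanGeometry.reflection_orthogonal_vadd h1 h2
    rw [vadd_eq_add, vadd_eq_add, add_sub_cancel] at this
    rw [this, two_mul, add_smul]
    abel

/-- Inverting the covering isometry and the scaling moves the fold into the fixed set P; L is the
linear part of the inverse isometry. -/
theorem IsOneFoldCover.exists_similarity {P F : Set Plane} {c : ℝ} (h : IsOneFoldCover c P)
    (hc : 0 < c) (hF : F ∈ singleFolds P) :
    ∃ (f : Plane → Plane) (L : Plane →ₗᵢ[ℝ] Plane), (∀ u ∈ F, f u ∈ P) ∧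
      ∀ u v, f u - f v = c⁻¹ • L (u - v) := by
  obtain ⟨_, ⟨g, rfl⟩, hg⟩ := h F hF
  refine ⟨fun u ↦ c⁻¹ • g.symm u,
    g.symm.toRealAffineIsometryEquiv.linearIsometryEquiv.toLinearIsometry, fun u hu ↦ ?_,
    fun u v ↦ ?_⟩
  · obtain ⟨_, ⟨x, hx, rfl⟩, rfl⟩ := hg hu
    simpa [hc.ne'] using hx
  · rw [← smul_sub]
    congr 1
    exact (g.symm.toRealAffineIsometryEquiv.map_vsub u v).symm

end Folding

/-! ### From a similarity into P to a placement -/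

namespace Folding

open scoped RealInnerProductSpace

theorem IsFrame.rotate {D N : Plane} (h : IsFrame D N) {c s : ℝ} (hcs : c ^ 2 + s ^ 2 = 1) :
    IsFrame (c • D - s • N) (c • N + s • D) := by
  have e : c • D - s • N = c • D + (-s) • N := by rw [neg_smul, sub_eq_add_neg]
  have e' : c • N + s • D = s • D + c • N := add_comm _ _
  rw [e, e']
  refine ⟨?_, ?_, ?_⟩
  · rw [h.inner_eq, h.inner_comb_fst, h.inner_comb_snd]
    linear_combination hcs
  · rw [h.inner_eq, h.inner_comb_fst, h.inner_comb_snd]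
    linear_combination hcs
  · rw [h.inner_eq, h.inner_comb_fst, h.inner_comb_snd, h.inner_comb_fst, h.inner_comb_snd]
    ring

theorem similarity_coords {f : Plane → Plane} {L : Plane →ₗᵢ[ℝ] Plane} {ρ C S : ℝ}
    {w n E M p u v : Plane} {α γ : ℝ} (hf : ∀ u v, f u - f v = ρ • L (u - v)) (hρ : 0 ≤ ρ)
    (hwn : IsFrame w n) (hEM : IsFrame E M) (hw : L w = C • E + S • M)
    (hn : L n = (-S) • E + C • M) (huv : u - v = α • w + γ • n) :
    ⟪f u - p, E⟫ = ⟪f v - p, E⟫ + ρ * (α * C - γ * S) ∧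
      ⟪f u - p, M⟫ = ⟪f v - p, M⟫ + ρ * (α * S + γ * C) ∧
      dist (f u) p ≤ dist (f v) p + ρ * (|α| + |γ|) := by
  have e1 : f u - p = (f v - p) + (f u - f v) := by abel
  have e2 : f u - f v = (ρ * (α * C - γ * S)) • E + (ρ * (α * S + γ * C)) • M := by
    rw [hf, huv, map_add, map_smul, map_smul, hw, hn]
    module
  refine ⟨?_, ?_, ?_⟩
  · rw [e1, inner_add_left, e2, hEM.inner_comb_fst]
  · rw [e1, inner_add_left, e2, hEM.inner_comb_snd]
  · have h1 : dist (f u) (f v) ≤ ρ * (|α| + |γ|) := by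
      rw [dist_eq_norm, hf, norm_smul, L.norm_map, Real.norm_of_nonneg hρ]
      have := hwn.norm_le (u - v)
      rw [huv, hwn.inner_comb_fst, hwn.inner_comb_snd] at this
      rw [huv]
      gcongr
    linarith [dist_triangle (f u) (f v) p]

/-- A similarity that maps the folded shape into `P` gives a placement. -/
theorem placement_of_similarity {P F : Set Plane} {a b D N E M p q : Plane} {f : Plane → Plane}
    {L : Plane →ₗᵢ[ℝ] Plane} {d τ t₁ t t' u' T₁ T₂ T₁' T₂' r r₀ R η s c ρ C S : ℝ}
    (hDN : IsFrame D N) (hEM : IsFrame E M) (hd : 0 < d) (hb : b = a + d • D)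
    (hq : q = p + d • E) (hdiam : ∀ u ∈ P, ∀ v ∈ P, dist u v ≤ d)
    (ha : IsCorner P a D N t₁ t r₀) (hb' : IsCorner P b (-D) N (-t') u' r₀)
    (hp : IsCorner P p E M T₁ T₂ R) (hq' : IsCorner P q (-E) M T₁' T₂' R)
    (haP : a ∈ P) (hbP : b ∈ P) (hcs : c ^ 2 + s ^ 2 = 1) (hs : 0 < s) (hc : 1 / 2 ≤ c)
    (ht : 0 < t)
    (hF : ∀ Z ∈ P, 0 ≤ ⟪Z - (a + (d / 2) • D), c • N + s • D⟫ → Z ∈ F)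
    (hF' : ∀ Z ∈ P, ⟪Z - (a + (d / 2) • D), c • N + s • D⟫ < 0 →
      Z - (2 * ⟪Z - (a + (d / 2) • D), c • N + s • D⟫) • (c • N + s • D) ∈ F)
    (hfP : ∀ u ∈ F, f u ∈ P) (hf : ∀ u v, f u - f v = ρ • L (u - v))
    (hw : L (c • D - s • N) = C • E + S • M) (hn : L (c • N + s • D) = (-S) • E + C • M)
    (hCS : C ^ 2 + S ^ 2 = 1) (hρ : 1 - s ^ 4 ≤ ρ) (hρ0 : 1 / 2 ≤ ρ) (hτ : 0 < τ)
    (hη : 16 * τ * η ≤ d) (hηd : 2 * η < d)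
    (hfa : dist (f (a + (d * s) • (c • N + s • D))) p < η) (hfb : dist (f b) q < η)
    (hr : 0 ≤ r) (hr₀ : r ≤ r₀) (hx : d / 2 * s / (s + t * c) ≤ r₀)
    (hxR : η + 4 * (d / 2 * s / (s + t * c)) * (1 + t) < R)
    (hz : d / 2 * s ≤ r * (s + t * c)) (hzR : η + 2 * (2 * r * (1 + t) + d * s) < R)
    (hy : 0 < t' → d / 2 * s / (s + t' * c) ≤ r₀ ∧
      η + 4 * (d / 2 * s / (s + t' * c)) * (1 + t') < R) (hηR : η < R) :
    Placement d τ t t' r T₁ T₂ T₁' T₂' s c ρ C S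
      ⟪f (a + (d * s) • (c • N + s • D)) - p, M⟫ ⟪f (a + (d * s) • (c • N + s • D)) - p, E⟫
      ⟪f b - q, M⟫ ⟪f b - q, -E⟫ := by
  have hwn := hDN.rotate hcs
  obtain ⟨w, hwdef⟩ : ∃ w, w = c • D - s • N := ⟨_, rfl⟩
  obtain ⟨n, hndef⟩ : ∃ n, n = c • N + s • D := ⟨_, rfl⟩
  rw [← hwdef, ← hndef] at hwn
  rw [← hndef] at hF hF' hn hfa ⊢
  rw [← hwdef] at hw
  have eD : D = c • w + s • n := by
    rw [hwdef, hndef]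
    have : D = (c ^ 2 + s ^ 2) • D := by rw [hcs, one_smul]
    nth_rewrite 1 [this]
    module
  have eN : N = c • n - s • w := by
    rw [hwdef, hndef]
    have : N = (c ^ 2 + s ^ 2) • N := by rw [hcs, one_smul]
    nth_rewrite 1 [this]
    module
  have hD : ⟪D, n⟫ = s := by rw [eD, hwn.inner_comb_snd]
  have hN : ⟪N, n⟫ = c := by
    rw [eN, sub_eq_add_neg, ← neg_smul, add_comm, hwn.inner_comb_snd]
  have side : ∀ x y : ℝ, ⟪a + (x • D + y • N) - (a + (d / 2) • D), n⟫ = (x - d / 2) * s + y * c := by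
    intro x y
    rw [add_sub_add_left_eq_sub, inner_sub_left, inner_add_left, real_inner_smul_left,
      real_inner_smul_left, real_inner_smul_left, hD, hN]
    ring
  have hρpos : 0 ≤ ρ := by linarith
  have hs1 : s ≤ 1 := by nlinarith only [hcs, sq_nonneg c, hs]
  have hc1 : c ≤ 1 := by nlinarith only [hcs, sq_nonneg s, hc]
  -- the reflected vertex
  obtain ⟨a', ha'⟩ : ∃ a', a' = a + (d * s) • n := ⟨_, rfl⟩
  rw [← ha'] at hfa ⊢
  have sa := side 0 0
  simp only [zero_smul, add_zero] at sa
  have ha'F : a' ∈ F := by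
    have := hF' a haP (by rw [sa]; linarith only [mul_pos hd hs])
    rw [sa] at this
    convert this using 1
    rw [ha']
    module
  have hbF : b ∈ F := by
    refine hF b hbP ?_
    have := side d 0
    rw [zero_smul, add_zero] at this
    rw [hb, this]
    linarith only [mul_pos hd hs]
  have hba : b - a' = (d * c) • w + (0 : ℝ) • n := by
    rw [hb, ha', eD]
    module
  obtain ⟨b1, b2, -⟩ := similarity_coords (p := p) hf hρpos hwn hEM hw hn hba
  have hbq : f b - q = (f b - p) - d • E := by rw [hq]; abel
  have b3 : ⟪f b - q, -E⟫ = d - ⟪f b - p, E⟫ := by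
    rw [hbq, inner_neg_right, inner_sub_left, real_inner_smul_left, hEM.1]
    ring
  have b4 : ⟪f b - q, M⟫ = ⟪f b - p, M⟫ := by
    rw [hbq, inner_sub_left, real_inner_smul_left, hEM.3]
    ring
  have ha'P := hfP a' ha'F
  have hbP' := hfP b hbF
  have hY := hp.nonneg ha'P (hfa.trans hηR)
  have hY' := hq'.nonneg hbP' (hfb.trans hηR)
  obtain ⟨l1, l2⟩ := hp.slope _ ha'P (hfa.trans hηR)
  obtain ⟨l3, l4⟩ := hq'.slope _ hbP' (hfb.trans hηR)
  have hρc : ρ * c ≤ 1 := by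
    have h1 := hdiam _ hbP' _ ha'P
    rw [dist_eq_norm, hf, hba, norm_smul, L.norm_map, zero_smul, add_zero, norm_smul, hwn.norm_fst,
      Real.norm_of_nonneg hρpos, Real.norm_of_nonneg (by positivity)] at h1
    refine le_of_mul_le_mul_left ?_ hd
    linarith only [h1]
  have small : ∀ (Z p V : Plane), ‖V‖ = 1 → dist Z p < η → |⟪Z - p, V⟫| ≤ η := by
    intro Z p V hV hZ
    have := abs_real_inner_le_norm (Z - p) V
    rw [hV, mul_one, ← dist_eq_norm] at this
    linarith
  have hρc' : 1 / 4 ≤ ρ * c := by nlinarith only [hρ0, hc]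
  -- If C were negative, the heights at the two ends would add up to at least d, although each is at
  -- most η.
  have hC : 0 ≤ C := by
    have h1 := small _ _ E hEM.norm_fst hfa
    have h2 := small _ _ (-E) (by rw [norm_neg, hEM.norm_fst]) hfb
    have h3 := (abs_le.1 h1).2
    have h4 := (abs_le.1 h2).2
    by_contra! hC
    rw [b3, b1] at h4
    have : ρ * (d * c * C - 0 * S) = d * (ρ * c * C) := by ring
    rw [this] at h4
    have : ρ * c * C ≤ 0 := mul_nonpos_of_nonneg_of_nonpos (by linarith) hC.le
    linarith only [mul_nonpos_of_nonneg_of_nonpos hd.le this, h3, h4, hηd]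
  -- The lateral positions at the ends are at most η and differ by dρc|S| ≥ d|S|/4; the hypothesis
  -- 16τη ≤ d is made for this.
  have hS : τ * |S| ≤ 1 / 2 := by
    have h1 := small _ _ M hEM.norm_snd hfa
    have h2 := small _ _ M hEM.norm_snd hfb
    rw [b4, b2] at h2
    have h3 : |ρ * (d * c * S + 0 * C)| ≤ 2 * η := by
      calc |ρ * (d * c * S + 0 * C)|
          = |(⟪f a' - p, M⟫ + ρ * (d * c * S + 0 * C)) - ⟪f a' - p, M⟫| := by
            rw [add_sub_cancel_left]
        _ ≤ _ := (abs_sub _ _).trans (by linarith)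
    have h4 : ρ * (d * c * S + 0 * C) = d * (ρ * c) * S := by ring
    rw [h4, abs_mul, abs_of_nonneg (show 0 ≤ d * (ρ * c) by positivity)] at h3
    have h5 : d * (1 / 4) * |S| ≤ 2 * η :=
      le_trans (by gcongr) h3
    have h6 : d * (τ * |S|) ≤ d * (1 / 2) := by
      linarith only [mul_le_mul_of_nonneg_left h5 hτ.le, hη]
    exact le_of_mul_le_mul_left h6 hd
  have hρ2 : ρ ≤ 2 := by nlinarith only [hρc, hc, hρ0]
  have far : ∀ {k u : ℝ}, 0 ≤ k → 0 < u → |k * (c - u * s)| ≤ k * (1 + u) := by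
    intro k u hk hu
    rw [abs_mul, abs_of_nonneg hk]
    refine mul_le_mul_of_nonneg_left (abs_le.2 ⟨?_, ?_⟩) hk
    · nlinarith only [hu, hs1, hc]
    · nlinarith only [mul_pos hu hs, hc1, hu]
  have half : ∀ {u : ℝ}, 0 < u → d / 2 * s / (s + u * c) * (s + u * c) = d / 2 * s := by
    intro u hu
    exact div_mul_cancel₀ _ (by positivity)
  have far' : ∀ {u : ℝ}, 0 < u → |d / 2 * s| ≤ d / 2 * s / (s + u * c) * (1 + u) := by
    intro u hu
    rw [abs_of_nonneg (by positivity), ← half hu]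
    have : 0 ≤ d / 2 * s / (s + u * c) := by positivity
    rw [half hu]
    nth_rewrite 1 [← half hu]
    refine mul_le_mul_of_nonneg_left ?_ this
    linarith only [hs1, mul_le_mul_of_nonneg_left hc1 hu.le]
  -- the point where the fold line crosses the right side at `a`
  obtain ⟨k, hk⟩ : ∃ k, k = d / 2 * s / (s + t * c) := ⟨_, rfl⟩
  have hk0 : 0 ≤ k := by rw [hk]; positivity
  have hxa := half ht
  have hfx := far hk0 ht
  have hfx' := far' ht
  rw [← hk] at hx hxR hxa hfx'
  have x1 : a + k • (D + t • N) ∈ P := ha.side_snd k hk0 hx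
  have x2 : a + k • (D + t • N) ∈ F := by
    refine hF _ x1 ?_
    rw [smul_add, smul_smul, side]
    linarith
  have x3 : a + k • (D + t • N) - a' = (k * (c - t * s)) • w + (-(d / 2 * s)) • n := by
    have e : -(d / 2 * s) = k * (s + t * c) - d * s := by linarith
    rw [e, ha']
    nth_rewrite 1 [eD]
    rw [eN]
    module
  obtain ⟨x4, x5, x6⟩ := similarity_coords (p := p) hf hρpos hwn hEM hw hn x3
  rw [abs_neg] at x6
  have x7 := (hp.slope _ (hfP _ x2) (by
    have h1 := mul_le_mul hρ2 (add_le_add hfx hfx') (by positivity) (by norm_num)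
    linarith only [h1, x6, hfa, hxR])).1
  -- a fixed point on the right side at `a`
  have z1 : a + r • (D + t • N) ∈ P := ha.side_snd r hr hr₀
  have z2 : a + r • (D + t • N) ∈ F := by
    refine hF _ z1 ?_
    rw [smul_add, smul_smul, side]
    linarith
  have z3 : a + r • (D + t • N) - a' =
      (r * (c - t * s)) • w + (r * (s + t * c) - d * s) • n := by
    rw [ha']
    nth_rewrite 1 [eD]
    rw [eN]
    module
  obtain ⟨z4, z5, z6⟩ := similarity_coords (p := p) hf hρpos hwn hEM hw hn z3
  have z7 := (hp.slope _ (hfP _ z2) (by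
    have h1 := far hr ht
    have h2 : |r * (s + t * c) - d * s| ≤ r * (1 + t) + d * s := by
      have : 0 ≤ d * s := by positivity
      have h3 : 0 ≤ r * (s + t * c) := by positivity
      have h4 : r * (s + t * c) ≤ r * (1 + t) := mul_le_mul_of_nonneg_left
        (by linarith only [hs1, mul_le_mul_of_nonneg_left hc1 ht.le]) hr
      exact abs_le.2 ⟨by linarith, by linarith⟩
    have h5 : ρ * (|r * (c - t * s)| + |r * (s + t * c) - d * s|) ≤
        2 * (r * (1 + t) + (r * (1 + t) + d * s)) := by gcongr
    linarith)).2
  refine ⟨hρ, hρc, hCS, hC, hS, ?_, ?_, hY, hY', l1, l2, l3, l4, ?_, ?_, fun ht' ↦ ?_⟩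
  · rw [b3, b1]; ring
  · rw [b4, b2]; ring
  · rw [← hk]
    rw [x4, x5] at x7
    linarith
  · rw [z4, z5] at z7
    linarith
  · obtain ⟨hy, hyR⟩ := hy ht'
    obtain ⟨k', hk'⟩ : ∃ k, k = d / 2 * s / (s + t' * c) := ⟨_, rfl⟩
    have hk0' : 0 ≤ k' := by rw [hk']; positivity
    have hyb := half ht'
    have hfy := far hk0' ht'
    have hfy' := far' ht'
    rw [← hk'] at hy hyR hyb hfy' ⊢
    have y1 := hb'.side_fst k' hk0' hy
    have y0 : b + k' • (-D + -t' • N) = a + ((d - k') • D + (-(k' * t')) • N) := by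
      rw [hb]; module
    have y2 : b + k' • (-D + -t' • N) ∈ F := by
      refine hF _ y1 ?_
      rw [y0, side]
      linarith
    have y3 : b + k' • (-D + -t' • N) - b = (-(k' * (c - t' * s))) • w + (-(d / 2 * s)) • n := by
      rw [← hyb, add_sub_cancel_left]
      nth_rewrite 1 [eD]
      rw [eN]
      module
    obtain ⟨y4, y5, y6⟩ := similarity_coords (p := q) hf hρpos hwn hEM hw hn y3
    rw [abs_neg, abs_neg] at y6
    have y7 : dist (f (b + k' • (-D + -t' • N))) q < R := by
      have h1 := mul_le_mul hρ2 (add_le_add hfy hfy') (by positivity) (by norm_num)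
      linarith only [h1, y6, hfb, hyR]
    have y8 := hq'.nonneg (hfP _ y2) y7
    have y9 := (hq'.slope _ (hfP _ y2) y7).1
    rw [inner_neg_right, y4] at y8 y9
    rw [y5] at y9
    rw [inner_neg_right]
    exact ⟨by linarith, by linarith⟩

end Folding

/-! ### Topology of the enclosed region and its corners -/

namespace Folding

open scoped RealInnerProductSpace
open Set Metric

section Region

variable {B : Set Plane}

theorem isClosed_enclosedRegion (hB : IsClosed B) : IsClosed (enclosedRegion B) := by
  rw [← isOpen_compl_iff, isOpen_iff_mem_nhds]
  intro x hx
  have hxB : x ∈ Bᶜ := fun h ↦ hx (Or.inl h)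
  have hunb : ¬ Bornology.IsBounded (connectedComponentIn Bᶜ x) := fun h ↦ hx (Or.inr ⟨hxB, h⟩)
  refine Filter.mem_of_superset
    (hB.isOpen_compl.connectedComponentIn.mem_nhds (mem_connectedComponentIn hxB)) ?_
  rintro y hy (h | ⟨-, h⟩)
  · exact connectedComponentIn_subset _ _ hy h
  · rw [← connectedComponentIn_eq hy] at h
    exact hunb h

/-- From a point x outside K, the ray pointing away from a point of K keeps increasing a separating
functional. It thus avoids B, and makes the component of x unbounded. -/
theorem enclosedRegion_subset {K : Set Plane} (hK : Convex ℝ K) (hKc : IsClosed K)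
    (hne : K.Nonempty) (hB : B ⊆ K) : enclosedRegion B ⊆ K := by
  rintro x (hx | ⟨hx, hbd⟩)
  · exact hB hx
  by_contra hxK
  obtain ⟨f, u, hf, hu⟩ := geometric_hahn_banach_closed_point hK hKc hxK
  obtain ⟨k, hk⟩ := hne
  have he : 0 < f (x - k) := by
    rw [map_sub]
    linarith [hf k hk]
  have he0 : x - k ≠ 0 := fun h ↦ by simp [h] at he
  have hray : IsPreconnected ((fun t : ℝ ↦ x + t • (x - k)) '' Ici 0) :=
    isPreconnected_Ici.image _ (by fun_prop)
  have hsub : (fun t : ℝ ↦ x + t • (x - k)) '' Ici 0 ⊆ connectedComponentIn Bᶜ x := by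
    refine hray.subset_connectedComponentIn ⟨0, self_mem_Ici, by simp⟩ ?_
    rintro _ ⟨t, ht, rfl⟩ hB'
    have h1 := hf _ (hB hB')
    have h2 : 0 ≤ t * f (x - k) := mul_nonneg ht he.le
    rw [map_add, map_smul, smul_eq_mul] at h1
    linarith
  obtain ⟨C, hC⟩ := (hbd.subset hsub).exists_norm_le
  have hn : 0 < ‖x - k‖ := norm_pos_iff.2 he0
  have hC0 : 0 ≤ C := (norm_nonneg _).trans (hC _ ⟨0, self_mem_Ici, rfl⟩)
  have h1 := hC _ ⟨(C + ‖x‖ + 1) / ‖x - k‖, div_nonneg (by positivity) hn.le, rfl⟩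
  have h2 : ‖((C + ‖x‖ + 1) / ‖x - k‖) • (x - k)‖ = C + ‖x‖ + 1 := by
    rw [norm_smul, Real.norm_of_nonneg (by positivity), div_mul_cancel₀ _ hn.ne']
  have h3 := norm_sub_le (x + ((C + ‖x‖ + 1) / ‖x - k‖) • (x - k)) x
  rw [add_sub_cancel_left, h2] at h3
  have h4 : ‖x + ((C + ‖x‖ + 1) / ‖x - k‖) • (x - k)‖ ≤ C := h1
  linarith

theorem convex_halfPlane (a V : Plane) : Convex ℝ {Z : Plane | 0 < ⟪Z - a, V⟫} := by
  intro x hx y hy α β hα hβ hαβ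
  have e : α • x + β • y - a = α • (x - a) + β • (y - a) := by
    nth_rewrite 1 [← one_smul ℝ a, ← hαβ]
    module
  simp only [mem_ofPred_eq] at hx hy ⊢
  rw [e, inner_add_left, real_inner_smul_left, real_inner_smul_left]
  rcases hα.eq_or_lt with rfl | hα
  · rw [zero_add] at hαβ
    simpa [hαβ] using hy
  · have := mul_pos hα hx
    have := mul_nonneg hβ hy.le
    linarith

/-- If `B` is the union of two segments near a point `a` of the enclosed region at maximal distance
from `b`, then the region has a corner at `a`. -/
theorem isCorner_enclosedRegion {a b D N : Plane} {d t₁ t₂ R : ℝ} (hDN : IsFrame D N)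
    (hb : b = a + d • D) (hd : 0 < d) (hdist : ∀ Z ∈ enclosedRegion B, dist Z b ≤ d)
    (ht : t₁ < t₂) (hR : 0 < R)
    (h₁ : ∀ s, 0 ≤ s → s ≤ R → a + s • (D + t₁ • N) ∈ B)
    (h₂ : ∀ s, 0 ≤ s → s ≤ R → a + s • (D + t₂ • N) ∈ B)
    (hB : ∀ Z ∈ B, dist Z a < R → ∃ s t : ℝ, 0 ≤ s ∧ (t = t₁ ∨ t = t₂) ∧ Z = a + s • (D + t • N)) :
    IsCorner (enclosedRegion B) a D N t₁ t₂ R := by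
  refine ⟨ht, hR, fun s h0 h1 ↦ Or.inl (h₁ s h0 h1), fun s h0 h1 ↦ Or.inl (h₂ s h0 h1), ?_⟩
  have coords : ∀ s t : ℝ, ⟪a + s • (D + t • N) - a, D⟫ = s ∧
      ⟪a + s • (D + t • N) - a, N⟫ = s * t := by
    intro s t
    rw [add_sub_cancel_left, smul_add, smul_smul]
    exact ⟨hDN.inner_comb_fst _ _, hDN.inner_comb_snd _ _⟩
  intro Z hZ hZa
  by_contra hcon
  let H₁ : Set Plane := {Z | 0 < ⟪Z - a, t₁ • D - N⟫}
  let H₂ : Set Plane := {Z | 0 < ⟪Z - a, N - t₂ • D⟫}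
  have hH₁ : ∀ Z, Z ∈ H₁ ↔ ⟪Z - a, N⟫ < t₁ * ⟪Z - a, D⟫ := by
    intro Z
    simp only [H₁, mem_ofPred_eq, inner_sub_right, real_inner_smul_right, sub_pos]
  have hH₂ : ∀ Z, Z ∈ H₂ ↔ t₂ * ⟪Z - a, D⟫ < ⟪Z - a, N⟫ := by
    intro Z
    simp only [H₂, mem_ofPred_eq, inner_sub_right, real_inner_smul_right, sub_pos]
  -- W lies behind a, opposite to the direction of the mean slope, and violates both slope
  -- conditions; e is small enough to keep W in the ball.
  set e : ℝ := R / (2 * (1 + |(t₁ + t₂) / 2|)) with he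
  have he0 : 0 < e := by positivity
  set W : Plane := a + (-e) • (D + ((t₁ + t₂) / 2) • N) with hW
  obtain ⟨w1, w2⟩ := coords (-e) ((t₁ + t₂) / 2)
  rw [← hW] at w1 w2
  have hWR : W ∈ ball a R := by
    rw [mem_ball, dist_eq_norm]
    refine (hDN.norm_le _).trans_lt ?_
    rw [w1, w2, abs_mul, abs_neg, abs_of_pos he0]
    have : e * (2 * (1 + |(t₁ + t₂) / 2|)) = R := div_mul_cancel₀ _ (by positivity)
    linarith
  have hW1 : W ∈ ball a R ∩ H₁ := ⟨hWR, (hH₁ W).2 (by rw [w1, w2]; nlinarith)⟩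
  have hW2 : W ∈ ball a R ∩ H₂ := ⟨hWR, (hH₂ W).2 (by rw [w1, w2]; nlinarith)⟩
  -- The part of the ball outside the angle is connected through W and misses B, so it lies in one
  -- component. If it met the region, W would belong to the region, yet W is farther than d from b.
  have hconn : IsPreconnected (ball a R ∩ H₁ ∪ ball a R ∩ H₂) :=
    IsPreconnected.union W hW1 hW2
      ((convex_ball a R).inter (convex_halfPlane _ _)).isPreconnected
      ((convex_ball a R).inter (convex_halfPlane _ _)).isPreconnected
  have hZS : Z ∈ ball a R ∩ H₁ ∪ ball a R ∩ H₂ := by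
    rw [← inter_union_distrib_left]
    refine ⟨hZa, ?_⟩
    by_contra hcon'
    rw [mem_union, hH₁, hH₂, not_or, not_lt, not_lt] at hcon'
    exact hcon hcon'
  have hSB : ball a R ∩ H₁ ∪ ball a R ∩ H₂ ⊆ Bᶜ := by
    rw [← inter_union_distrib_left]
    rintro Y ⟨hY, hYH⟩ hYB
    obtain ⟨s, t, hs, ht', rfl⟩ := hB Y hYB hY
    obtain ⟨y1, y2⟩ := coords s t
    rw [mem_union, hH₁, hH₂, y1, y2] at hYH
    rcases ht' with rfl | rfl <;> rcases hYH with h | h <;> nlinarith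
  have hsub := hconn.subset_connectedComponentIn hZS hSB
  have hWB : W ∉ B := hSB (Or.inl hW1)
  have hWP : W ∈ enclosedRegion B := by
    rcases hZ with hZ | ⟨-, hZ⟩
    · exact absurd hZ (hSB hZS)
    · refine Or.inr ⟨hWB, ?_⟩
      rw [← connectedComponentIn_eq (hsub (Or.inl hW1))]
      exact hZ
  have h1 := hdist W hWP
  have h2 : ⟪W - b, D⟫ = -e - d := by
    have : W - b = W - a - d • D := by rw [hb]; abel
    rw [this, inner_sub_left, w1, real_inner_smul_left, hDN.1, mul_one]
  have h3 := abs_real_inner_le_norm (W - b) D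
  rw [h2, hDN.norm_fst, mul_one, ← dist_eq_norm, abs_of_neg (by linarith)] at h3
  linarith

end Region

/-! ### Diameters of a simple polygon -/

section Polygons

variable {n : ℕ} {v : Polygon Plane n}

theorem edgeSet_eq_segment (v : Polygon Plane n) (i : Fin n) :
    v.edgeSet ℝ i = segment ℝ (v i) (v (finRotate n i)) :=
  affineSegment_eq_segment _ _ _

theorem isCompact_edgeSet (v : Polygon Plane n) (i : Fin n) : IsCompact (v.edgeSet ℝ i) := by
  rw [edgeSet_eq_segment, segment_eq_image_lineMap]
  exact isCompact_Icc.image (AffineMap.lineMap_continuous)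

theorem isCompact_boundary (v : Polygon Plane n) : IsCompact (v.boundary ℝ) :=
  isCompact_iUnion fun i ↦ isCompact_edgeSet v i

theorem vertex_mem_edgeSet (v : Polygon Plane n) (i : Fin n) : v i ∈ v.edgeSet ℝ i := by
  rw [edgeSet_eq_segment]
  exact left_mem_segment _ _ _

theorem edgeSet_subset_boundary (v : Polygon Plane n) (i : Fin n) :
    v.edgeSet ℝ i ⊆ v.boundary ℝ :=
  subset_iUnion (fun i ↦ v.edgeSet ℝ i) i

theorem vertex_mem_region (v : Polygon Plane n) (i : Fin n) :
    v i ∈ enclosedRegion (v.boundary ℝ) :=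
  Or.inl (edgeSet_subset_boundary v i (vertex_mem_edgeSet v i))

theorem region_subset_convexHull (v : Polygon Plane n) [NeZero n] :
    enclosedRegion (v.boundary ℝ) ⊆ convexHull ℝ (range v.vertices) := by
  refine enclosedRegion_subset (convex_convexHull ℝ _)
    ((finite_range _).isClosed_convexHull ℝ) ((range_nonempty _).convexHull) ?_
  refine iUnion_subset fun i ↦ ?_
  rw [edgeSet_eq_segment]
  exact segment_subset_convexHull (mem_range_self _) (mem_range_self _)

theorem isCompact_region (v : Polygon Plane n) [NeZero n] :
    IsCompact (enclosedRegion (v.boundary ℝ)) :=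
  ((finite_range v.vertices).isCompact_convexHull ℝ).of_isClosed_subset
    (isClosed_enclosedRegion (isCompact_boundary v).isClosed) (region_subset_convexHull v)

/-- A point of a region at maximal distance from a point is a vertex. -/
theorem exists_vertex_of_forall_dist_le [NeZero n] {a b : Plane} {d : ℝ}
    (ha : a ∈ enclosedRegion (v.boundary ℝ))
    (hd : ∀ Z ∈ enclosedRegion (v.boundary ℝ), dist Z b ≤ d) (hab : dist a b = d) :
    ∃ i, v i = a := by
  have hsub : convexHull ℝ (range v.vertices) ⊆ closedBall b d := by
    refine convexHull_min ?_ (convex_closedBall b d)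
    rintro _ ⟨i, rfl⟩
    exact hd _ (vertex_mem_region v i)
  -- The hull lies in the ball of radius d about b, which is strictly convex, so a boundary point of
  -- the ball is extreme in the hull.
  have hext : a ∈ (convexHull ℝ (range v.vertices)).extremePoints ℝ := by
    refine ⟨region_subset_convexHull v ha, fun x hx y hy hxy ↦ ?_⟩
    by_contra hne
    have hxy' : x ≠ y := by
      rintro rfl
      rw [openSegment_same] at hxy
      exact hne hxy.symm
    have := (strictConvex_closedBall ℝ b d).openSegment_subset (hsub hx) (hsub hy) hxy' hxy
    rw [interior_closedBall', mem_ball] at this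
    linarith
  obtain ⟨i, hi⟩ := extremePoints_convexHull_subset hext
  exact ⟨i, hi⟩

theorem IsSimple.finRotate_ne (hv : IsSimple v) (i : Fin n) : finRotate n i ≠ i := by
  have h3 := hv.three_le
  obtain ⟨m, rfl⟩ : ∃ m, n = m + 3 := ⟨n - 3, by omega⟩
  rw [finRotate_apply]
  intro h
  have h0 : (1 : Fin (m + 3)) = 0 := by simp at h
  exact absurd (congrArg Fin.val h0) (by simp)

/-- Expanding the distance condition gives |p - a|² ≤ 2d⟪p - a, D⟫, so p - a has a positive
component along D. -/
theorem exists_slope_of_dist_le {a D N p : Plane} {d : ℝ} (hDN : IsFrame D N) (hd : 0 < d)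
    (hp : p ≠ a) (hdist : dist p (a + d • D) ≤ d) :
    ∃ w t : ℝ, 0 < w ∧ p = a + w • (D + t • N) := by
  have h1 : ⟪p - a, p - a⟫ ≤ 2 * d * ⟪p - a, D⟫ := by
    have e : p - (a + d • D) = (p - a) - d • D := by abel
    rw [dist_eq_norm, ← sq_le_sq₀ (norm_nonneg _) hd.le, e, norm_sub_sq_real, norm_smul,
      hDN.norm_fst, Real.norm_of_nonneg hd.le, real_inner_smul_right] at hdist
    rw [real_inner_self_eq_norm_sq]
    linarith
  have h2 : 0 < ⟪p - a, p - a⟫ := real_inner_self_pos.2 (sub_ne_zero.2 hp)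
  have h3 : 0 < ⟪p - a, D⟫ := by
    by_contra! h
    nlinarith
  refine ⟨⟪p - a, D⟫, ⟪p - a, N⟫ / ⟪p - a, D⟫, h3, ?_⟩
  rw [smul_add, smul_smul, mul_div_cancel₀ _ h3.ne', ← hDN.eq_sum, add_sub_cancel]

theorem mem_segment_add {a u : Plane} {r w : ℝ} (hr : 0 ≤ r) (hrw : r ≤ w) (hw : 0 < w) :
    a + r • u ∈ segment ℝ a (a + w • u) := by
  rw [segment_eq_image']
  refine ⟨r / w, ⟨div_nonneg hr hw.le, (div_le_one hw).2 hrw⟩, ?_⟩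
  simp only [add_sub_cancel_left, smul_smul]
  rw [div_mul_cancel₀ _ hw.ne']

theorem exists_of_mem_segment_add {a u Z : Plane} {w : ℝ} (hw : 0 < w)
    (hZ : Z ∈ segment ℝ a (a + w • u)) : ∃ r : ℝ, 0 ≤ r ∧ Z = a + r • u := by
  rw [segment_eq_image'] at hZ
  obtain ⟨θ, hθ, rfl⟩ := hZ
  exact ⟨θ * w, mul_nonneg hθ.1 hw.le, by simp only [add_sub_cancel_left, smul_smul]⟩

/-- A simple polygon has a corner at every vertex that is the endpoint of a diameter. -/
theorem IsSimple.exists_isCorner (hv : IsSimple v) (i : Fin n) {D N : Plane} {d : ℝ}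
    (hDN : IsFrame D N) (hd : 0 < d)
    (hdist : ∀ Z ∈ enclosedRegion (v.boundary ℝ), dist Z (v i + d • D) ≤ d) :
    ∃ t₁ t₂ R, IsCorner (enclosedRegion (v.boundary ℝ)) (v i) D N t₁ t₂ R := by
  obtain ⟨j, hj⟩ : ∃ j, finRotate n j = i := ⟨(finRotate n).symm i, (finRotate n).apply_symm_apply i⟩
  have hji : j ≠ i := by
    rintro rfl
    exact hv.finRotate_ne _ hj
  have hne₁ : v (finRotate n i) ≠ v i := fun h ↦ hv.finRotate_ne i (hv.injective h)
  have hne₂ : v j ≠ v i := fun h ↦ hji (hv.injective h)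
  obtain ⟨w₁, t₁, hw₁, h₁⟩ := exists_slope_of_dist_le hDN hd hne₁ (hdist _ (vertex_mem_region v _))
  obtain ⟨w₂, t₂, hw₂, h₂⟩ := exists_slope_of_dist_le hDN hd hne₂ (hdist _ (vertex_mem_region v _))
  have e₁ : v.edgeSet ℝ i = segment ℝ (v i) (v i + w₁ • (D + t₁ • N)) := by
    rw [edgeSet_eq_segment, h₁]
  have e₂ : v.edgeSet ℝ j = segment ℝ (v i) (v i + w₂ • (D + t₂ • N)) := by
    rw [edgeSet_eq_segment, segment_symm, hj, h₂]
  have hcons := hv.consecutive j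
  rw [hj, e₁, e₂] at hcons
  have hne : t₁ ≠ t₂ := by
    rintro rfl
    have hmin : 0 < min w₁ w₂ := lt_min hw₁ hw₂
    have : v i + (min w₁ w₂) • (D + t₁ • N) ∈ ({v i} : Set Plane) := by
      rw [← hcons]
      exact ⟨mem_segment_add hmin.le (min_le_right _ _) hw₂,
        mem_segment_add hmin.le (min_le_left _ _) hw₁⟩
    rw [mem_singleton_iff, add_eq_left, smul_eq_zero] at this
    have h0 : D + t₁ • N = 0 := this.resolve_left hmin.ne'
    have := hDN.inner_comb_fst 1 t₁
    rw [one_smul, h0, inner_zero_left] at this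
    exact zero_ne_one this
  have hfar : v i ∉ ⋃ k ∈ ({i, j}ᶜ : Set (Fin n)), v.edgeSet ℝ k := by
    simp only [mem_iUnion, not_exists]
    rintro k hk hik
    rw [mem_compl_iff, mem_insert_iff, mem_singleton_iff, not_or] at hk
    obtain ⟨hki, hkj⟩ := hk
    by_cases hk' : k = finRotate n i
    · have := hv.consecutive i
      rw [← hk'] at this
      have h : v i ∈ ({v.vertices k} : Set Plane) := by
        rw [← this]
        exact ⟨vertex_mem_edgeSet v i, hik⟩
      exact hki (hv.injective h).symm
    · refine disjoint_left.1 (hv.disjoint i k hki hk' ?_) (vertex_mem_edgeSet v i) hik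
      intro h
      exact hkj ((finRotate n).injective (hj.trans h)).symm
  have hclosed : IsClosed (⋃ k ∈ ({i, j}ᶜ : Set (Fin n)), v.edgeSet ℝ k) :=
    (toFinite _).isClosed_biUnion fun k _ ↦ (isCompact_edgeSet v k).isClosed
  obtain ⟨ε, hε, hball⟩ := Metric.isOpen_iff.1 hclosed.isOpen_compl _ hfar
  set R := min ε (min w₁ w₂) with hR
  have hR0 : 0 < R := lt_min hε (lt_min hw₁ hw₂)
  have hRw₁ : R ≤ w₁ := (min_le_right _ _).trans (min_le_left _ _)
  have hRw₂ : R ≤ w₂ := (min_le_right _ _).trans (min_le_right _ _)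
  have s₁ : ∀ s, 0 ≤ s → s ≤ R → v i + s • (D + t₁ • N) ∈ v.boundary ℝ := fun s h0 h1 ↦
    edgeSet_subset_boundary v i (by rw [e₁]; exact mem_segment_add h0 (h1.trans hRw₁) hw₁)
  have s₂ : ∀ s, 0 ≤ s → s ≤ R → v i + s • (D + t₂ • N) ∈ v.boundary ℝ := fun s h0 h1 ↦
    edgeSet_subset_boundary v j (by rw [e₂]; exact mem_segment_add h0 (h1.trans hRw₂) hw₂)
  have hloc : ∀ Z ∈ v.boundary ℝ, dist Z (v i) < R →
      ∃ s t : ℝ, 0 ≤ s ∧ (t = t₁ ∨ t = t₂) ∧ Z = v i + s • (D + t • N) := by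
    intro Z hZ hZi
    obtain ⟨k, hk⟩ := mem_iUnion.1 hZ
    by_cases hki : k = i
    · rw [hki, e₁] at hk
      obtain ⟨r, hr, rfl⟩ := exists_of_mem_segment_add hw₁ hk
      exact ⟨r, t₁, hr, Or.inl rfl, rfl⟩
    by_cases hkj : k = j
    · rw [hkj, e₂] at hk
      obtain ⟨r, hr, rfl⟩ := exists_of_mem_segment_add hw₂ hk
      exact ⟨r, t₂, hr, Or.inr rfl, rfl⟩
    · refine absurd (mem_biUnion (x := k) ?_ hk) (hball (mem_ball.2 (hZi.trans_le (min_le_left _ _))))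
      simp [hki, hkj]
  rcases hne.lt_or_gt with hlt | hlt
  · exact ⟨t₁, t₂, R, isCorner_enclosedRegion hDN rfl hd hdist hlt hR0 s₁ s₂ hloc⟩
  · refine ⟨t₂, t₁, R, isCorner_enclosedRegion hDN rfl hd hdist hlt hR0 s₂ s₁ fun Z hZ hZi ↦ ?_⟩
    obtain ⟨s, t, hs, ht, h⟩ := hloc Z hZ hZi
    exact ⟨s, t, hs, ht.symm, h⟩

theorem IsSimple.exists_diam (hv : IsSimple v) :
    ∃ d : ℝ, 0 < d ∧ (∀ u ∈ enclosedRegion (v.boundary ℝ), ∀ w ∈ enclosedRegion (v.boundary ℝ),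
      dist u w ≤ d) ∧ ∃ i j, dist (v i) (v j) = d := by
  have h3 := hv.three_le
  have : NeZero n := ⟨by omega⟩
  have hc := isCompact_region v
  obtain ⟨⟨a, b⟩, ⟨ha, hb⟩, hmax⟩ := (hc.prod hc).exists_isMaxOn
    ⟨(v 0, v 0), vertex_mem_region v 0, vertex_mem_region v 0⟩
    (f := fun x : Plane × Plane ↦ dist x.1 x.2) (by fun_prop)
  have hd : ∀ u ∈ enclosedRegion (v.boundary ℝ), ∀ w ∈ enclosedRegion (v.boundary ℝ),
      dist u w ≤ dist a b := fun u hu w hw ↦ hmax (a := (u, w)) ⟨hu, hw⟩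
  obtain ⟨i, hi⟩ := exists_vertex_of_forall_dist_le ha (fun Z hZ ↦ hd Z hZ b hb) rfl
  obtain ⟨j, hj⟩ := exists_vertex_of_forall_dist_le hb
    (fun Z hZ ↦ (dist_comm Z a).trans_le (hd a ha Z hZ)) (dist_comm b a)
  refine ⟨dist a b, ?_, hd, i, j, by rw [hi, hj]⟩
  refine lt_of_lt_of_le (dist_pos.2 fun h ↦ hv.finRotate_ne 0 (hv.injective h))
    (hd (v (finRotate n 0)) (vertex_mem_region v _) (v 0) (vertex_mem_region v 0))

/-- Points of the region at almost maximal distance are close to the endpoints of a diameter. -/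
theorem IsSimple.exists_near_diam (hv : IsSimple v) {d : ℝ}
    (hd : ∀ u ∈ enclosedRegion (v.boundary ℝ), ∀ w ∈ enclosedRegion (v.boundary ℝ),
      dist u w ≤ d) {η : ℝ} (hη : 0 < η) :
    ∃ δ > 0, ∀ u ∈ enclosedRegion (v.boundary ℝ), ∀ w ∈ enclosedRegion (v.boundary ℝ),
      d - δ < dist u w → ∃ i j, dist (v i) (v j) = d ∧ dist u (v i) < η ∧ dist w (v j) < η := by
  have h3 := hv.three_le
  have : NeZero n := ⟨by omega⟩
  have hc := isCompact_region v
  let U : Set (Plane × Plane) := ⋃ i, ⋃ j, ⋃ (_ : dist (v i) (v j) = d), ball (v i) η ×ˢ ball (v j) η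
  have hU : IsOpen U := isOpen_iUnion fun i ↦ isOpen_iUnion fun j ↦ isOpen_iUnion fun _ ↦
    isOpen_ball.prod isOpen_ball
  have hmem : ∀ u w, (u, w) ∈ U ↔
      ∃ i j, dist (v i) (v j) = d ∧ dist u (v i) < η ∧ dist w (v j) < η := by
    intro u w
    simp only [U, mem_iUnion, mem_prod, mem_ball, exists_prop]
  -- Pairs away from all diameters form a compact set, on which the distance has a maximum below d;
  -- the gap serves as δ.
  have hK := (hc.prod hc).diff hU
  rcases (enclosedRegion (v.boundary ℝ) ×ˢ enclosedRegion (v.boundary ℝ) \ U).eq_empty_or_nonempty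
    with hemp | hne
  · refine ⟨1, one_pos, fun u hu w hw _ ↦ (hmem u w).1 ?_⟩
    by_contra h
    have : (u, w) ∈ (∅ : Set (Plane × Plane)) := by
      rw [← hemp]
      exact ⟨⟨hu, hw⟩, h⟩
    exact this
  · obtain ⟨⟨a, b⟩, ⟨⟨ha, hb⟩, hab⟩, hmax⟩ := hK.exists_isMaxOn hne
      (f := fun x : Plane × Plane ↦ dist x.1 x.2) (by fun_prop)
    refine ⟨d - dist a b, ?_, fun u hu w hw huw ↦ (hmem u w).1 ?_⟩
    · refine sub_pos.2 (lt_of_le_of_ne (hd a ha b hb) fun h ↦ hab ((hmem a b).2 ?_))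
      obtain ⟨i, hi⟩ := exists_vertex_of_forall_dist_le ha (fun Z hZ ↦ hd Z hZ b hb) h
      obtain ⟨j, hj⟩ := exists_vertex_of_forall_dist_le hb
        (fun Z hZ ↦ (dist_comm Z a).trans_le (hd a ha Z hZ)) ((dist_comm b a).trans h)
      exact ⟨i, j, by rw [hi, hj, h], by simpa [hi] using hη, by simpa [hj] using hη⟩
    · by_contra h
      have := hmax (a := (u, w)) ⟨⟨hu, hw⟩, h⟩
      simp only [mem_ofPred_eq] at this
      linarith

end Polygons

end Folding

/-! ### The extremal diameter and the contradiction -/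

namespace Folding

open scoped RealInnerProductSpace Topology
open Set Metric Filter

/-- The vector `v` turned by a right angle. -/
noncomputable def quarterTurn (v : Plane) : Plane := !₂[-v 1, v 0]

theorem isFrame_quarterTurn {D : Plane} (hD : ‖D‖ = 1) : IsFrame D (quarterTurn D) := by
  have h : ⟪D, D⟫ = 1 := by rw [real_inner_self_eq_norm_sq, hD, one_pow]
  refine ⟨h, ?_, ?_⟩
  · rw [inner_eq_coords] at h ⊢
    simp only [quarterTurn, PiLp.toLp_apply, Matrix.cons_val_zero, Matrix.cons_val_one]
    linarith
  · rw [inner_eq_coords]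
    simp only [quarterTurn, PiLp.toLp_apply, Matrix.cons_val_zero, Matrix.cons_val_one]
    ring

/-- The sign encoding one of the two orientations of the plane. -/
def orientationSign (σ : Bool) : ℝ := if σ then 1 else -1

variable {n : ℕ} {v : Polygon Plane n}

/-- The direction from one endpoint of a diameter to the other one. -/
noncomputable def diamDir (v : Polygon Plane n) (d : ℝ) (i j : Fin n) : Plane :=
  d⁻¹ • (v j - v i)

/-- A unit vector orthogonal to a diameter. -/
noncomputable def diamNormal (v : Polygon Plane n) (d : ℝ) (i j : Fin n) (σ : Bool) : Plane :=
  orientationSign σ • quarterTurn (diamDir v d i j)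

theorem norm_diamDir {d : ℝ} (hd : 0 < d) {i j : Fin n} (hij : dist (v i) (v j) = d) :
    ‖diamDir v d i j‖ = 1 := by
  rw [diamDir, norm_smul, ← dist_eq_norm, dist_comm, hij, norm_inv, Real.norm_of_nonneg hd.le,
    inv_mul_cancel₀ hd.ne']

theorem add_smul_diamDir {d : ℝ} (hd : 0 < d) (i j : Fin n) : v j = v i + d • diamDir v d i j := by
  rw [diamDir, smul_inv_smul₀ hd.ne', add_sub_cancel]

theorem isFrame_diam {d : ℝ} (hd : 0 < d) {i j : Fin n} (hij : dist (v i) (v j) = d) (σ : Bool) :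
    IsFrame (diamDir v d i j) (diamNormal v d i j σ) := by
  have h := isFrame_quarterTurn (norm_diamDir hd hij)
  cases σ
  · simpa [diamNormal, orientationSign] using h.neg_right
  · simpa [diamNormal, orientationSign] using h

/-- The slopes of the corners at both endpoints of every diameter. -/
structure DiamCorners (v : Polygon Plane n) (d R τ : ℝ)
    (T₁ T₂ T₁' T₂' : Fin n × Fin n × Bool → ℝ) : Prop where
  corner : ∀ i j σ, dist (v i) (v j) = d → IsCorner (enclosedRegion (v.boundary ℝ)) (v i)
    (diamDir v d i j) (diamNormal v d i j σ) (T₁ (i, j, σ)) (T₂ (i, j, σ)) R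
  corner' : ∀ i j σ, dist (v i) (v j) = d → IsCorner (enclosedRegion (v.boundary ℝ)) (v j)
    (-diamDir v d i j) (diamNormal v d i j σ) (T₁' (i, j, σ)) (T₂' (i, j, σ)) R
  mirror₁ : ∀ i j σ, T₁ (i, j, !σ) = -T₂ (i, j, σ)
  mirror₂ : ∀ i j σ, T₂ (i, j, !σ) = -T₁ (i, j, σ)
  mirror₁' : ∀ i j σ, T₁' (i, j, !σ) = -T₂' (i, j, σ)
  bound : ∀ k, -τ ≤ T₁ k ∧ T₂ k ≤ τ ∧ -τ ≤ T₁' k ∧ T₂' k ≤ τ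

/-- Slopes are chosen for one orientation and mirrored for the other, so the mirror identities hold
for all indices. Finiteness gives a common radius and slope bound. -/
theorem IsSimple.exists_diamCorners (hv : IsSimple v) {d : ℝ} (hd : 0 < d)
    (hdiam : ∀ u ∈ enclosedRegion (v.boundary ℝ), ∀ w ∈ enclosedRegion (v.boundary ℝ),
      dist u w ≤ d) :
    ∃ R τ T₁ T₂ T₁' T₂', 0 < R ∧ 1 ≤ τ ∧ DiamCorners v d R τ T₁ T₂ T₁' T₂' := by
  have h3 := hv.three_le
  have : NeZero n := ⟨by omega⟩
  have key : ∀ i j, ∃ t₁ t₂ t₁' t₂' R, 0 < R ∧ (dist (v i) (v j) = d →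
      IsCorner (enclosedRegion (v.boundary ℝ)) (v i) (diamDir v d i j) (diamNormal v d i j true)
        t₁ t₂ R ∧
      IsCorner (enclosedRegion (v.boundary ℝ)) (v j) (-diamDir v d i j) (diamNormal v d i j true)
        t₁' t₂' R) := by
    intro i j
    by_cases hij : dist (v i) (v j) = d
    · have hf := isFrame_diam hd hij true
      have hji := add_smul_diamDir (v := v) hd i j
      obtain ⟨t₁, t₂, R, h⟩ := hv.exists_isCorner i hf hd
        (fun Z hZ ↦ by rw [← hji]; exact hdiam Z hZ _ (vertex_mem_region v j))
      obtain ⟨t₁', t₂', R', h'⟩ := hv.exists_isCorner j hf.neg_left hd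
        (fun Z hZ ↦ by
          rw [smul_neg, ← sub_eq_add_neg, ← eq_sub_of_add_eq hji.symm]
          exact hdiam Z hZ _ (vertex_mem_region v i))
      have hR := lt_min h.pos h'.pos
      exact ⟨t₁, t₂, t₁', t₂', min R R', hR,
        fun _ ↦ ⟨h.mono hR (min_le_left _ _), h'.mono hR (min_le_right _ _)⟩⟩
    -- Dummy values for pairs that do not span a diameter; the radius must still be positive for the
    -- minimum.
    · exact ⟨0, 0, 0, 0, 1, one_pos, fun h ↦ absurd h hij⟩
  choose t₁ t₂ t₁' t₂' R hR hcor using key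
  obtain ⟨⟨i₀, j₀⟩, hmin⟩ := Finite.exists_min fun x : Fin n × Fin n ↦ R x.1 x.2
  obtain ⟨⟨i₁, j₁⟩, hmax⟩ := Finite.exists_max fun x : Fin n × Fin n ↦
    |t₁ x.1 x.2| + |t₂ x.1 x.2| + |t₁' x.1 x.2| + |t₂' x.1 x.2|
  have hneg : ∀ i j, diamNormal v d i j false = -diamNormal v d i j true := by
    intro i j
    simp [diamNormal, orientationSign]
  refine ⟨R i₀ j₀, |t₁ i₁ j₁| + |t₂ i₁ j₁| + |t₁' i₁ j₁| + |t₂' i₁ j₁| + 1,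
    fun k ↦ if k.2.2 then t₁ k.1 k.2.1 else -t₂ k.1 k.2.1,
    fun k ↦ if k.2.2 then t₂ k.1 k.2.1 else -t₁ k.1 k.2.1,
    fun k ↦ if k.2.2 then t₁' k.1 k.2.1 else -t₂' k.1 k.2.1,
    fun k ↦ if k.2.2 then t₂' k.1 k.2.1 else -t₁' k.1 k.2.1, hR _ _, ?_, ?_, ?_, ?_, ?_, ?_, ?_⟩
  · have : 0 ≤ |t₁ i₁ j₁| + |t₂ i₁ j₁| + |t₁' i₁ j₁| + |t₂' i₁ j₁| := by positivity
    linarith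
  · intro i j σ hij
    have h := ((hcor i j hij).1).mono (hR i₀ j₀) (hmin (i, j))
    cases σ
    · rw [hneg]
      exact h.neg
    · exact h
  · intro i j σ hij
    have h := ((hcor i j hij).2).mono (hR i₀ j₀) (hmin (i, j))
    cases σ
    · rw [hneg]
      exact h.neg
    · exact h
  · intro i j σ
    cases σ <;> simp
  · intro i j σ
    cases σ <;> simp
  · intro i j σ
    cases σ <;> simp
  · rintro ⟨i, j, σ⟩
    have h := hmax (i, j)
    simp only at h
    have a1 := abs_le.1 (le_refl |t₁ i j|)
    have a2 := abs_le.1 (le_refl |t₂ i j|)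
    have a3 := abs_le.1 (le_refl |t₁' i j|)
    have a4 := abs_le.1 (le_refl |t₂' i j|)
    have b1 := abs_nonneg (t₁ i j)
    have b2 := abs_nonneg (t₂ i j)
    have b3 := abs_nonneg (t₁' i j)
    have b4 := abs_nonneg (t₂' i j)
    cases σ
    · simp only [Bool.false_eq_true, if_false]
      exact ⟨by linarith, by linarith, by linarith, by linarith⟩
    · simp only [if_true]
      exact ⟨by linarith, by linarith, by linarith, by linarith⟩

/-- If the region almost covers all its folds, then every fold along a line close to a diameter can
be placed at some diameter. -/
theorem DiamCorners.eventually_placement {d R τ : ℝ} {T₁ T₂ T₁' T₂' : Fin n × Fin n × Bool → ℝ}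
    (h : DiamCorners v d R τ T₁ T₂ T₁' T₂') (hv : IsSimple v) (hd : 0 < d) (hR : 0 < R)
    (hτ : 1 ≤ τ)
    (hdiam : ∀ u ∈ enclosedRegion (v.boundary ℝ), ∀ w ∈ enclosedRegion (v.boundary ℝ),
      dist u w ≤ d)
    (hcov : ∀ ε > 0, ∃ c, 0 < c ∧ c < 1 + ε ∧ IsOneFoldCover c (enclosedRegion (v.boundary ℝ)))
    {i j : Fin n} {σ : Bool} (hij : dist (v i) (v j) = d) (ht : 0 < T₂ (i, j, σ)) :
    ∃ r > 0, ∀ᶠ s in 𝓝[>] (0 : ℝ), ∃ k : Fin n × Fin n × Bool, dist (v k.1) (v k.2.1) = d ∧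
      ∃ ρ C S X Y X' Y', Placement d τ (T₂ (i, j, σ)) (-T₁' (i, j, σ)) r (T₁ k) (T₂ k) (T₁' k)
        (T₂' k) s (√(1 - s ^ 2)) ρ C S X Y X' Y' := by
  set t := T₂ (i, j, σ) with htdef
  obtain ⟨t', ht'⟩ : ∃ t', t' = -T₁' (i, j, σ) := ⟨_, rfl⟩
  rw [← ht']
  -- With this r, the bound η ≤ R/4 and ds < R/16, the retained point lands within 7R/8 of the
  -- target vertex.
  obtain ⟨r, hr⟩ : ∃ r, r = R / (8 * (1 + t)) := ⟨_, rfl⟩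
  have hr0 : 0 < r := by rw [hr]; positivity
  have hrt : r * (8 * (1 + t)) = R := by rw [hr]; exact div_mul_cancel₀ _ (by positivity)
  have hrR : r ≤ R := by nlinarith [mul_pos hr0 ht]
  obtain ⟨η, hη⟩ : ∃ η, η = min (R / 4) (d / (32 * τ)) := ⟨_, rfl⟩
  have hη0 : 0 < η := by rw [hη]; exact lt_min (by positivity) (by positivity)
  have hηR : η ≤ R / 4 := by rw [hη]; exact min_le_left _ _
  have hητ : η * (32 * τ) ≤ d := by
    rw [← le_div_iff₀ (by positivity), hη]
    exact min_le_right _ _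
  have hηd : η * 32 ≤ d := by nlinarith
  obtain ⟨δ, hδ, hnear⟩ := hv.exists_near_diam hdiam hη0
  refine ⟨r, hr0, ?_⟩
  have c0 : ContinuousAt (fun s : ℝ ↦ √(1 - s ^ 2)) 0 := by fun_prop
  have q0 : ∀ u : ℝ, 0 < u →
      ContinuousAt (fun s : ℝ ↦ d / 2 * s / (s + u * √(1 - s ^ 2))) 0 := fun u hu ↦
    ContinuousAt.div (by fun_prop) (by fun_prop) (by simpa using hu.ne')
  have lt_ev : ∀ {f : ℝ → ℝ} {b : ℝ}, ContinuousAt f 0 → f 0 < b → ∀ᶠ s in 𝓝[>] (0 : ℝ), f s < b :=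
    fun hf hb ↦ (hf.eventually_lt continuousAt_const hb).filter_mono nhdsWithin_le_nhds
  have gt_ev : ∀ {f : ℝ → ℝ} {b : ℝ}, ContinuousAt f 0 → b < f 0 → ∀ᶠ s in 𝓝[>] (0 : ℝ), b < f s :=
    fun hf hb ↦ (continuousAt_const.eventually_lt hf hb).filter_mono nhdsWithin_le_nhds
  have ev1 := gt_ev (b := 1 / 2) c0 (by norm_num)
  have evq : ∀ u : ℝ, 0 < u → ∀ᶠ s in 𝓝[>] (0 : ℝ), d / 2 * s / (s + u * √(1 - s ^ 2)) ≤ R ∧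
      η + 4 * (d / 2 * s / (s + u * √(1 - s ^ 2))) * (1 + u) < R := fun u hu ↦ by
    have e1 := lt_ev (b := R) (q0 u hu) (by simpa using hR)
    have e2 := lt_ev (f := fun s ↦ η + 4 * (d / 2 * s / (s + u * √(1 - s ^ 2))) * (1 + u)) (b := R)
      (((q0 u hu).const_mul 4).mul_const (1 + u) |>.const_add η) (by simp; linarith)
    filter_upwards [e1, e2] with s h1 h2 using ⟨h1.le, h2⟩
  have ev2 := evq t ht
  have ev3 : ∀ᶠ s in 𝓝[>] (0 : ℝ), 0 < t' → d / 2 * s / (s + t' * √(1 - s ^ 2)) ≤ R ∧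
      η + 4 * (d / 2 * s / (s + t' * √(1 - s ^ 2))) * (1 + t') < R := by
    by_cases h0 : 0 < t'
    · filter_upwards [evq t' h0] with s hs _ using hs
    · exact Eventually.of_forall fun s hs ↦ absurd hs h0
  have ev4 := gt_ev (f := fun s ↦ r * (s + t * √(1 - s ^ 2)) - d / 2 * s) (b := 0) (by fun_prop)
    (by simpa using mul_pos hr0 ht)
  have ev5 := lt_ev (f := fun s ↦ d * s) (b := R / 16) (by fun_prop) (by simpa using hR)
  have ev6 := gt_ev (f := fun s ↦ (1 - s ^ 4) * (d * √(1 - s ^ 2))) (b := d - δ) (by fun_prop)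
    (by simpa using hδ)
  have ev7 : ∀ᶠ s in 𝓝[>] (0 : ℝ), 0 < s ∧ s ≤ 1 / 2 :=
    Filter.eventually_of_mem (Ioc_mem_nhdsGT (by norm_num : (0 : ℝ) < 1 / 2)) fun s hs ↦ hs
  filter_upwards [ev1, ev2, ev3, ev4, ev5, ev6, ev7] with s h1 h2 h3 h4 h5 h6 h7
  obtain ⟨hs, hs1⟩ := h7
  have hs2 : s ^ 2 ≤ 1 / 4 := by nlinarith only [hs, hs1]
  have hs4 : s ^ 4 ≤ 1 / 2 := by nlinarith only [hs2, sq_nonneg s]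
  obtain ⟨c, hc⟩ : ∃ c, c = √(1 - s ^ 2) := ⟨_, rfl⟩
  rw [← hc] at h1 h2 h3 h4 h6 ⊢
  have hcs : c ^ 2 + s ^ 2 = 1 := by
    rw [hc, Real.sq_sqrt (by linarith)]
    ring
  have hDN := isFrame_diam hd hij σ
  have hb := add_smul_diamDir (v := v) hd i j
  set D := diamDir v d i j
  set N := diamNormal v d i j σ
  have hwn := hDN.rotate hcs
  have hDn : ⟪D, c • N + s • D⟫ = s := by
    rw [real_inner_comm, add_comm, hDN.inner_comb_fst]
  obtain ⟨F, hFs, hF, hF'⟩ := exists_fold (enclosedRegion (v.boundary ℝ))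
    (v i + (d / 2) • D) hwn ⟨v i, vertex_mem_region v i, by
      rw [sub_add_cancel_left, inner_neg_left, real_inner_smul_left, hDn]
      linarith only [mul_pos hd hs]⟩
  -- A defect of s⁴ in the ratio is negligible in the comparison of terms of order s².
  obtain ⟨e, he, he1, hecov⟩ := hcov (s ^ 4) (by positivity)
  obtain ⟨f, L, hfP, hf⟩ := hecov.exists_similarity he hFs
  have hρ : 1 - s ^ 4 ≤ e⁻¹ := by
    rw [← one_div, le_div_iff₀ he]
    nlinarith only [he1, hs4, sq_nonneg (s ^ 4)]
  obtain ⟨ρ, hρe⟩ : ∃ ρ, ρ = e⁻¹ := ⟨_, rfl⟩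
  rw [← hρe] at hf hρ
  have hLwn : IsFrame (L (c • D - s • N)) (L (c • N + s • D)) := by
    refine ⟨?_, ?_, ?_⟩
    · rw [L.inner_map_map, hwn.1]
    · rw [L.inner_map_map, hwn.2]
    · rw [L.inner_map_map, hwn.3]
  obtain ⟨a', ha'⟩ : ∃ a', a' = v i + (d * s) • (c • N + s • D) := ⟨_, rfl⟩
  have ha'F : a' ∈ F := by
    have e1 : ⟪v i - (v i + (d / 2) • D), c • N + s • D⟫ = -(d / 2 * s) := by
      rw [sub_add_cancel_left, inner_neg_left, real_inner_smul_left, hDn]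
    have := hF' (v i) (vertex_mem_region v i) (by rw [e1]; linarith only [mul_pos hd hs])
    rw [e1] at this
    convert this using 1
    rw [ha']
    module
  have hbF : v j ∈ F := by
    refine hF _ (vertex_mem_region v j) ?_
    rw [hb, add_sub_add_left_eq_sub, ← sub_smul, real_inner_smul_left, hDn]
    linarith only [mul_pos hd hs]
  have hdist : dist (f a') (f (v j)) = ρ * (d * c) := by
    have e1 : a' - v j = (-(d * c)) • (c • D - s • N) := by
      rw [ha', hb]
      have : D = (c ^ 2 + s ^ 2) • D := by rw [hcs, one_smul]
      nth_rewrite 2 [this]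
      module
    rw [dist_eq_norm, hf, e1, norm_smul, L.norm_map, norm_smul, hwn.norm_fst,
      Real.norm_of_nonneg (by linarith), norm_neg, Real.norm_of_nonneg (by positivity), mul_one]
  obtain ⟨i', j', hij', hi', hj'⟩ := hnear _ (hfP _ ha'F) _ (hfP _ hbF) (by
    rw [hdist]
    exact h6.trans_le (by gcongr))
  -- The similarity may reverse orientation; the sign goes into the orientation of the target
  -- diameter.
  obtain ⟨σ₀, C, S, hσ₀, hCS, hw, hn⟩ := (isFrame_quarterTurn (norm_diamDir hd hij')).exists_rotation
    hLwn
  obtain ⟨σ', hσ'⟩ : ∃ σ', diamNormal v d i' j' σ' = σ₀ • quarterTurn (diamDir v d i' j') := by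
    rcases hσ₀ with rfl | rfl
    · exact ⟨true, by simp [diamNormal, orientationSign]⟩
    · exact ⟨false, by simp [diamNormal, orientationSign]⟩
  rw [← hσ'] at hw hn
  have hb' := h.corner' i j σ hij
  have hT : T₁' (i, j, σ) = -t' := by rw [ht', neg_neg]
  rw [hT] at hb'
  rw [ha'] at hi'
  exact ⟨(i', j', σ'), hij', ρ, C, S, _, _, _, _,
    placement_of_similarity hDN (isFrame_diam hd hij' σ') hd hb (add_smul_diamDir hd i' j') hdiam
      (h.corner i j σ hij) hb' (h.corner i' j' σ' hij') (h.corner' i' j' σ' hij')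
      (vertex_mem_region v i) (vertex_mem_region v j) hcs hs h1.le ht hF hF' hfP hf hw hn hCS hρ
      (by linarith) (by linarith) (by linarith) (by linarith) hi' hj' hr0.le hrR h2.1 h2.2
      (by linarith) (by linarith) h3 (by linarith)⟩

theorem IsSimple.one_lt_oneFoldCoverFactor (hv : IsSimple v) :
    1 < oneFoldCoverFactor (enclosedRegion (v.boundary ℝ)) := by
  by_contra! hle
  have hcov : ∀ ε > 0, ∃ c, 0 < c ∧ c < 1 + ε ∧
      IsOneFoldCover c (enclosedRegion (v.boundary ℝ)) := by
    intro ε hε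
    have h1 : oneFoldCoverFactor (enclosedRegion (v.boundary ℝ)) < ENNReal.ofReal (1 + ε) := by
      refine hle.trans_lt ?_
      rw [← ENNReal.ofReal_one]
      exact (ENNReal.ofReal_lt_ofReal_iff (by linarith)).2 (by linarith)
    obtain ⟨c, hc⟩ := iInf_lt_iff.1 h1
    obtain ⟨⟨hc0, hcov⟩, hc⟩ := iInf_lt_iff.1 hc
    exact ⟨c, hc0, (ENNReal.ofReal_lt_ofReal_iff (by linarith)).1 hc, hcov⟩
  obtain ⟨d, hd, hdiam, i₀, j₀, hij₀⟩ := hv.exists_diam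
  obtain ⟨R, τ, T₁, T₂, T₁', T₂', hR, hτ, hT⟩ := hv.exists_diamCorners hd hdiam
  -- Maximize the slope t first, then how far the same corner reaches on the other side, then t' at
  -- the opposite end.
  obtain ⟨⟨i, j, σ⟩, hij, hmax⟩ := Set.exists_max_image
    {k : Fin n × Fin n × Bool | dist (v k.1) (v k.2.1) = d}
    (fun k ↦ toLex (T₂ k, toLex (-T₁ k, -T₁' k))) (Set.toFinite _) ⟨(i₀, j₀, true), hij₀⟩
  have hij : dist (v i) (v j) = d := hij
  have lex : ∀ i' j' σ', dist (v i') (v j') = d → T₂ (i', j', σ') < T₂ (i, j, σ) ∨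
      T₂ (i', j', σ') = T₂ (i, j, σ) ∧ (-T₁ (i', j', σ') < -T₁ (i, j, σ) ∨
        -T₁ (i', j', σ') = -T₁ (i, j, σ) ∧ -T₁' (i', j', σ') ≤ -T₁' (i, j, σ)) := by
    intro i' j' σ' h'
    have := hmax (i', j', σ') h'
    simpa only [Prod.Lex.toLex_le_toLex, Prod.Lex.toLex_lt_toLex] using this
  have le₂ : ∀ i' j' σ', dist (v i') (v j') = d → T₂ (i', j', σ') ≤ T₂ (i, j, σ) := by
    intro i' j' σ' h'
    rcases lex i' j' σ' h' with h | h
    · exact h.le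
    · exact h.1.le
  have le₁ : ∀ i' j' σ', dist (v i') (v j') = d → -T₁ (i', j', σ') ≤ T₂ (i, j, σ) := by
    intro i' j' σ' h'
    rw [← hT.mirror₂]
    exact le₂ i' j' _ h'
  have ht : 0 < T₂ (i, j, σ) := by
    have := le₁ i j σ hij
    have := (hT.corner i j σ hij).lt
    linarith
  obtain ⟨r, hr, hev⟩ := hT.eventually_placement hv hd hR hτ hdiam hcov hij ht
  -- There are finitely many target diameters, so one of them serves for arbitrarily small s.
  obtain ⟨⟨i', j', σ'⟩, hfreq⟩ : ∃ k : Fin n × Fin n × Bool, ∃ᶠ s in 𝓝[>] (0 : ℝ),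
      dist (v k.1) (v k.2.1) = d ∧ ∃ ρ C S X Y X' Y', Placement d τ (T₂ (i, j, σ))
        (-T₁' (i, j, σ)) r (T₁ k) (T₂ k) (T₁' k) (T₂' k) s (√(1 - s ^ 2)) ρ C S X Y X' Y' := by
    by_contra hcon
    have hcon' := fun k ↦ not_frequently.1 (not_exists.1 hcon k)
    obtain ⟨s, hs, k, hk⟩ := ((eventually_all.2 hcon').and hev).exists
    exact hs k hk
  have hij' : dist (v i') (v j') = d := by
    obtain ⟨s, hs⟩ := hfreq.exists
    exact hs.1
  obtain ⟨b₁, b₂, b₁', b₂'⟩ := hT.bound (i', j', σ')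
  obtain ⟨s, ρ, C, S, X, Y, X', Y', hseq⟩ := exists_placementSeq hd hτ b₁ b₂ b₁' b₂'
    (hfreq.mono fun s hs ↦ hs.2)
  have k₁ : -T₁ (i', j', σ') = T₂ (i, j, σ) :=
    le_antisymm (le₁ _ _ _ hij') (le_neg_of_le_neg (hseq.left_le hd ht))
  have k₂ : T₂ (i', j', σ') = T₂ (i, j, σ) := le_antisymm (le₂ _ _ _ hij') (hseq.le_right hr)
  have m₁ := le₁ i j σ hij
  have l₁ := lex i' j' σ' hij'
  have l₂ := lex i' j' (!σ') hij'
  have l₃ := lex i j (!σ) hij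
  rw [hT.mirror₁, hT.mirror₂, hT.mirror₁', neg_neg, neg_neg] at l₂ l₃
  rw [k₁, k₂] at l₁ l₂
  -- The target attains the largest values in the first two entries, so the maximal triple attains
  -- them as well. Hence the target, its mirror image and the mirrored source all tie there, and the
  -- third entry decides.
  have e₁ : -T₁ (i, j, σ) = T₂ (i, j, σ) := by
    rcases l₁ with h | ⟨-, h | ⟨h, -⟩⟩ <;> linarith
  have f₁ : -T₁' (i', j', σ') ≤ -T₁' (i, j, σ) := by
    rcases l₁ with h | ⟨-, h | ⟨-, h⟩⟩ <;> linarith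
  have f₂ : T₂' (i', j', σ') ≤ -T₁' (i, j, σ) := by
    rcases l₂ with h | ⟨-, h | ⟨-, h⟩⟩ <;> linarith
  have f₃ : T₂' (i, j, σ) ≤ -T₁' (i, j, σ) := by
    rcases l₃ with h | ⟨-, h | ⟨-, h⟩⟩ <;> linarith
  -- The corner at b satisfies T₁' < T₂' ≤ -T₁'.
  have ht' : 0 < -T₁' (i, j, σ) := by
    have := (hT.corner' i j σ hij).lt
    linarith
  exact hseq.false hd ht ht' (by linarith) k₂.le (by linarith) f₂

end Folding

theorem mainTheorem5 (P : Set Folding.Plane) (hP : Folding.IsPlanePolygon P) :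
    (∃ F ∈ Folding.singleFolds P, ∀ g : Folding.Plane ≃ᵢ Folding.Plane, ¬ F ⊆ g '' P) ∧
      1 < Folding.oneFoldCoverFactor P := by
  obtain ⟨n, v, hv, rfl⟩ := hP
  have h := hv.one_lt_oneFoldCoverFactor
  refine ⟨?_, h⟩
  -- If isometric copies covered every fold, the scale 1 would be admissible and the factor at most
  -- 1.
  by_contra! hcon
  refine h.not_ge ((iInf₂_le 1 ⟨one_pos, fun F hF ↦ ?_⟩).trans_eq ENNReal.ofReal_one)
  obtain ⟨g, hg⟩ := hcon F hF
  exact ⟨_, ⟨g, rfl⟩, by rwa [one_smul]⟩
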